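/- A network with mark space $\Xi$ (a complete separable metric space) is a multigraph $G$ (loops and multiple edges allowed) with a mark in $\Xi$ at every vertex and two marks in $\Xi$ on every edge, one at each of its endpoints. Let $\mathcal G_*(\Xi)$ be the set of rooted-isomorphism classes $[G,o]$ of connected locally finite networks with a root $o$, where isomorphisms preserve marks. It carries the local metric: the distance of $[G_1,o_1]$ and $[G_2,o_2]$ is $1/(1+\alpha)$, where $\alpha$ is the supremum of those $r>0$ for which there is a rooted isomorphism of the balls of radius $\lfloor r\rfloor$ around the roots such that corresponding marks have distance less than $1/r$. Let $\mathcal G_{**}(\Xi)$ be the analogous space of classes $[G,x,y]$ with an ordered pair of distinguished vertices. A Borel probability measure $\mu$ on $\mathcal G_*(\Xi)$ is called unimodular if for every Borel $f:\mathcal G_{**}(\Xi)\to[0,\infty]$, $$\int\sum_{x\in V(G)}f(G,o,x)\,d\mu[G,o]=\int\sum_{x\in V(G)}f(G,x,o)\,d\mu[G,o].$$ Let $\Xi=\mathbb R^+=[0,\infty)$, and let $\mu_1,\mu_2$ be unimodular probability measures on $\mathcal G_*(\mathbb R^+)$ such that, for $i=1,2$, $\mu_i$-almost surely the two marks of each edge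 agree; this common mark is the weight of the edge. Suppose that there is a unimodular $\le$-coupling $\nu$ of $\mu_1$ to $\mu_2$, that is, a unimodular probability measure $\nu$ on $\mathcal G_*(\mathbb R^+\times\mathbb R^+)$ that is concentrated on networks all of whose (vertex and edge) marks $(a,b)$ satisfy $a\le b$, and such that for $i=1,2$ the image of $\nu$ under replacing every mark by its $i$-th coordinate is $\mu_i$. For $t>0$ and a network $G$ with these edge weights, let $P_t(x,y)$, $x,y\in V(G)$, be the transition probabilities of the continuous-time random walk on $G$ that jumps from $x$ to $z\ne x$ at rate equal to the sum of the weights of the edges joining $x$ and $z$; when the weights or the degrees are unbounded, this is the minimal process, which dies after an explosion. Denote by $P^{(i)}_t$ these transition probabilities under $\mu_i$. Then for all $t>0$, $$\int P^{(1)}_t(o,o)\,d\mu_1[G,o]\ \ge\ \int P^{(2)}_t(o,o)\,d\mu_2[G,o].$$ -/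

import Mathlib

open MeasureTheory Set
open scoped NNReal ENNReal

noncomputable section

namespace UnimodularNetwork

/-- A network with mark space `Ξ`: an undirected multigraph (loops and multiple edges allowed)
with a mark at each vertex and two marks on each edge, one at each of its endpoints.
`D` is the set of oriented edges; `rev` reverses the orientation, so an (unoriented) edge is a
pair `{d, rev d}`.  The mark of the edge of `d` at the endpoint `src d` is `emark d`. -/
structure Network (Ξ : Type) where
  V : Type
  D : Type
  src : D → V
  rev : D → D
  rev_rev : ∀ d, rev (rev d) = d
  rev_ne : ∀ d, rev d ≠ d
  vmark : V → Ξ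
  emark : D → Ξ

namespace Network

variable {Ξ Ξ' : Type}

/-- The endpoint of an oriented edge. -/
def dst (G : Network Ξ) (d : G.D) : G.V := G.src (G.rev d)

/-- The simple graph of adjacency; used for connectedness and the graph distance. -/
def simpleGraph (G : Network Ξ) : SimpleGraph G.V :=
  SimpleGraph.fromRel fun x y => ∃ d, G.src d = x ∧ G.dst d = y

/-- All degrees are finite. -/
def LocallyFinite (G : Network Ξ) : Prop := ∀ x, {d | G.src d = x}.Finite

/-- The subnetwork induced on a set of vertices. -/
def induce (G : Network Ξ) (A : Set G.V) : Network Ξ where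
  V := A
  D := {d : G.D // G.src d ∈ A ∧ G.dst d ∈ A}
  src d := ⟨G.src d.1, d.2.1⟩
  rev d := ⟨G.rev d.1, d.2.2, by simpa [dst, G.rev_rev] using d.2.1⟩
  rev_rev d := Subtype.ext (G.rev_rev d.1)
  rev_ne d h := G.rev_ne d.1 (congrArg Subtype.val h)
  vmark x := G.vmark x.1
  emark d := G.emark d.1

/-- Replace every mark by its image under `f`. -/
def mapMarks (f : Ξ → Ξ') (G : Network Ξ) : Network Ξ' where
  V := G.V
  D := G.D
  src := G.src
  rev := G.rev
  rev_rev := G.rev_rev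
  rev_ne := G.rev_ne
  vmark x := f (G.vmark x)
  emark d := f (G.emark d)

/-- All vertex marks and all edge marks lie in `R`. -/
def MarksIn (R : Set Ξ) (G : Network Ξ) : Prop :=
  (∀ x, G.vmark x ∈ R) ∧ ∀ d, G.emark d ∈ R

/-- The two marks of each edge agree. -/
def SymmetricEdgeMarks (G : Network Ξ) : Prop := ∀ d, G.emark (G.rev d) = G.emark d

/-- An isomorphism of the underlying multigraphs (marks are ignored). -/
structure GraphIso (G : Network Ξ) (H : Network Ξ') where
  onV : G.V ≃ H.V
  onD : G.D ≃ H.D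
  map_src : ∀ d, H.src (onD d) = onV (G.src d)
  map_rev : ∀ d, onD (G.rev d) = H.rev (onD d)

/-- The graph isomorphism preserves all marks. -/
def GraphIso.PreservesMarks {G H : Network Ξ} (φ : GraphIso G H) : Prop :=
  (∀ x, H.vmark (φ.onV x) = G.vmark x) ∧ ∀ d, H.emark (φ.onD d) = G.emark d

/-- Corresponding marks have distance less than `ε`. -/
def GraphIso.MarksWithin [PseudoMetricSpace Ξ] {G H : Network Ξ} (φ : GraphIso G H) (ε : ℝ) :
    Prop :=
  (∀ x, dist (G.vmark x) (H.vmark (φ.onV x)) < ε) ∧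
    ∀ d, dist (G.emark d) (H.emark (φ.onD d)) < ε

def GraphIso.refl (G : Network Ξ) : GraphIso G G :=
  ⟨Equiv.refl _, Equiv.refl _, fun _ => rfl, fun _ => rfl⟩

def GraphIso.symm {G : Network Ξ} {H : Network Ξ'} (φ : GraphIso G H) : GraphIso H G where
  onV := φ.onV.symm
  onD := φ.onD.symm
  map_src d := by rw [Equiv.eq_symm_apply, ← φ.map_src, Equiv.apply_symm_apply]
  map_rev d := by rw [Equiv.symm_apply_eq, φ.map_rev, Equiv.apply_symm_apply]

def GraphIso.trans {G H K : Network Ξ} (φ : GraphIso G H) (ψ : GraphIso H K) : GraphIso G K where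
  onV := φ.onV.trans ψ.onV
  onD := φ.onD.trans ψ.onD
  map_src d := by simp [ψ.map_src, φ.map_src]
  map_rev d := by simp [ψ.map_rev, φ.map_rev]

theorem GraphIso.map_dst {G : Network Ξ} {H : Network Ξ'} (φ : GraphIso G H) (d : G.D) :
    H.dst (φ.onD d) = φ.onV (G.dst d) := by
  unfold dst
  rw [← φ.map_rev, φ.map_src]

end Network

/-- A connected locally finite network with an ordered `k`-tuple of distinguished vertices. -/
structure RootedNetwork (Ξ : Type) (k : ℕ) where
  net : Network Ξ
  connected : net.simpleGraph.Connected
  locallyFinite : net.LocallyFinite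
  root : Fin k → net.V

namespace RootedNetwork

variable {Ξ Ξ' : Type} {k : ℕ}

/-- Rooted isomorphism: all marks and all distinguished vertices are preserved. -/
def Isomorphic (G H : RootedNetwork Ξ k) : Prop :=
  ∃ φ : Network.GraphIso G.net H.net, φ.PreservesMarks ∧ ∀ i, φ.onV (G.root i) = H.root i

instance setoid (Ξ : Type) (k : ℕ) : Setoid (RootedNetwork Ξ k) where
  r := Isomorphic
  iseqv :=
    { refl := fun G => ⟨.refl _, ⟨fun _ => rfl, fun _ => rfl⟩, fun _ => rfl⟩
      symm := by
        rintro G H ⟨φ, ⟨hv, he⟩, hr⟩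
        refine ⟨φ.symm, ⟨fun x => ?_, fun d => ?_⟩, fun i => ?_⟩
        · rw [← hv]; simp [Network.GraphIso.symm]
        · rw [← he]; simp [Network.GraphIso.symm]
        · rw [← hr]; simp [Network.GraphIso.symm]
      trans := by
        rintro G H K ⟨φ, ⟨hv, he⟩, hr⟩ ⟨ψ, ⟨hv', he'⟩, hr'⟩
        refine ⟨φ.trans ψ, ⟨fun x => ?_, fun d => ?_⟩, fun i => ?_⟩
        · simp [Network.GraphIso.trans, hv, hv']
        · simp [Network.GraphIso.trans, he, he']
        · simp [Network.GraphIso.trans, hr, hr'] }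

/-- Vertices at graph distance at most `⌊r⌋` from some distinguished vertex. -/
def ball (G : RootedNetwork Ξ k) (r : ℝ) : Set G.net.V :=
  {x | ∃ i, G.net.simpleGraph.dist (G.root i) x ≤ ⌊r⌋₊}

theorem root_mem_ball (G : RootedNetwork Ξ k) (r : ℝ) (i : Fin k) : G.root i ∈ G.ball r :=
  ⟨i, by simp⟩

/-- There is a rooted isomorphism of the balls of radius `⌊r⌋` around the distinguished vertices
such that each pair of corresponding marks has distance less than `1 / r`. -/
def Close [PseudoMetricSpace Ξ] (r : ℝ) (G H : RootedNetwork Ξ k) : Prop :=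
  ∃ φ : Network.GraphIso (G.net.induce (G.ball r)) (H.net.induce (H.ball r)),
    φ.MarksWithin (1 / r) ∧
      ∀ i, φ.onV ⟨G.root i, G.root_mem_ball r i⟩ = ⟨H.root i, H.root_mem_ball r i⟩

def mapMarks (f : Ξ → Ξ') (G : RootedNetwork Ξ k) : RootedNetwork Ξ' k where
  net := G.net.mapMarks f
  connected := G.connected
  locallyFinite := G.locallyFinite
  root := G.root

/-- The same network with other distinguished vertices. -/
def reroot (G : RootedNetwork Ξ k) {l : ℕ} (v : Fin l → G.net.V) : RootedNetwork Ξ l where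
  net := G.net
  connected := G.connected
  locallyFinite := G.locallyFinite
  root := v

end RootedNetwork

/-- Isomorphism classes of connected locally finite networks with `k` distinguished vertices.
`NetworkSpace Ξ 1` is the space of rooted networks, and `NetworkSpace Ξ 2` the space of networks
with an ordered pair of distinguished vertices. -/
def NetworkSpace (Ξ : Type) (k : ℕ) : Type 1 := Quotient (RootedNetwork.setoid Ξ k)

namespace NetworkSpace

variable {Ξ Ξ' : Type} {k : ℕ}

/-- The isomorphism class of a network with distinguished vertices. -/
def mk (G : RootedNetwork Ξ k) : NetworkSpace Ξ k := Quotient.mk _ G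

/-- The local distance `1 / (1 + α)`, where `α` is the supremum of those `r > 0` for which the
balls of radius `⌊r⌋` are isomorphic with corresponding marks at distance less than `1 / r`. -/
def localDist [PseudoMetricSpace Ξ] (p q : NetworkSpace Ξ k) : ℝ≥0∞ :=
  (1 + ⨆ r : {r : ℝ // 0 < r ∧ ∃ G H, mk G = p ∧ mk H = q ∧ RootedNetwork.Close r G H},
    ENNReal.ofReal r.1)⁻¹

/-- The topology of the local distance. -/
instance [PseudoMetricSpace Ξ] : TopologicalSpace (NetworkSpace Ξ k) where
  IsOpen U := ∀ p ∈ U, ∃ ε > 0, ∀ q, localDist p q < ε → q ∈ U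
  isOpen_univ := fun _ _ => ⟨1, one_pos, fun _ _ => mem_univ _⟩
  isOpen_inter := by
    intro U W hU hW p hp
    obtain ⟨ε, hε, h⟩ := hU p hp.1
    obtain ⟨δ, hδ, h'⟩ := hW p hp.2
    exact ⟨min ε δ, lt_min hε hδ, fun q hq =>
      ⟨h q (hq.trans_le (min_le_left _ _)), h' q (hq.trans_le (min_le_right _ _))⟩⟩
  isOpen_sUnion := by
    intro S hS p hp
    obtain ⟨U, hU, hpU⟩ := hp
    obtain ⟨ε, hε, h⟩ := hS U hU p hpU
    exact ⟨ε, hε, fun q hq => ⟨U, hU, h q hq⟩⟩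

instance [PseudoMetricSpace Ξ] : MeasurableSpace (NetworkSpace Ξ k) := borel _

instance [PseudoMetricSpace Ξ] : BorelSpace (NetworkSpace Ξ k) := ⟨rfl⟩

/-- Replace every mark by its image under `f`. -/
def mapMarks (f : Ξ → Ξ') : NetworkSpace Ξ k → NetworkSpace Ξ' k :=
  Quotient.lift (fun G => mk (G.mapMarks f)) (by
    rintro G H ⟨φ, ⟨hv, he⟩, hr⟩
    exact Quotient.sound ⟨⟨φ.onV, φ.onD, φ.map_src, φ.map_rev⟩,
      ⟨fun x => congrArg f (hv x), fun d => congrArg f (he d)⟩, hr⟩)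

/-- All vertex marks and edge marks lie in `R`. -/
def MarksIn (R : Set Ξ) (p : NetworkSpace Ξ k) : Prop := ∀ G, mk G = p → G.net.MarksIn R

/-- Edge marks are the same at both ends of each edge. -/
def SymmetricEdgeMarks (p : NetworkSpace Ξ k) : Prop := ∀ G, mk G = p → G.net.SymmetricEdgeMarks

/-- The total mass `∑ x, f (G, o, x)` sent from the root `o`. -/
def massOut (f : NetworkSpace Ξ 2 → ℝ≥0∞) : NetworkSpace Ξ 1 → ℝ≥0∞ :=
  Quotient.lift (fun G => ∑' x : G.net.V, f (mk (G.reroot ![G.root 0, x]))) (by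
    rintro G H ⟨φ, hm, hr⟩
    rw [← φ.onV.tsum_eq]
    refine tsum_congr fun x => congrArg f (Quotient.sound ⟨φ, hm, fun i => ?_⟩)
    fin_cases i
    · exact hr 0
    · rfl)

/-- The total mass `∑ x, f (G, x, o)` received by the root `o`. -/
def massIn (f : NetworkSpace Ξ 2 → ℝ≥0∞) : NetworkSpace Ξ 1 → ℝ≥0∞ :=
  Quotient.lift (fun G => ∑' x : G.net.V, f (mk (G.reroot ![x, G.root 0]))) (by
    rintro G H ⟨φ, hm, hr⟩
    rw [← φ.onV.tsum_eq]
    refine tsum_congr fun x => congrArg f (Quotient.sound ⟨φ, hm, fun i => ?_⟩)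
    fin_cases i
    · rfl
    · exact hr 0)

end NetworkSpace

/-- Unimodular probability measures on rooted networks: the Mass-Transport Principle holds. -/
def IsUnimodular {Ξ : Type} [PseudoMetricSpace Ξ] (μ : Measure (NetworkSpace Ξ 1)) : Prop :=
  IsProbabilityMeasure μ ∧ ∀ f : NetworkSpace Ξ 2 → ℝ≥0∞, Measurable f →
    ∫⁻ p, NetworkSpace.massOut f p ∂μ = ∫⁻ p, NetworkSpace.massIn f p ∂μ

/-- `ν` is an `R`-coupling of `μ₁` to `μ₂`: a probability measure on rooted networks with mark
space `Ξ × Ξ`, concentrated on networks all of whose marks lie in `R`, whose marginal given by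
taking the `i`-th coordinate of every mark is `μᵢ`. -/
structure IsCoupling {Ξ : Type} [PseudoMetricSpace Ξ] (R : Set (Ξ × Ξ))
    (ν : Measure (NetworkSpace (Ξ × Ξ) 1)) (μ₁ μ₂ : Measure (NetworkSpace Ξ 1)) : Prop where
  prob : IsProbabilityMeasure ν
  marksIn : ∀ᵐ p ∂ν, NetworkSpace.MarksIn R p
  fst : ν.map (NetworkSpace.mapMarks Prod.fst) = μ₁
  snd : ν.map (NetworkSpace.mapMarks Prod.snd) = μ₂

section Walk

variable {V W : Type}

/-- The total rate of leaving `x`. -/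
def exitRate (q : V → V → ℝ≥0∞) (x : V) : ℝ := (∑' z, q x z).toReal

open Classical in
/-- For the continuous-time Markov chain with jump rates `q x z` from `x` to `z`, the probability,
starting from `x`, that exactly `n` jumps are made by time `t` and that the chain is then at `y`.
The recursion conditions on the time `s` and the target `z` of the first jump. -/
def jumpProb (q : V → V → ℝ≥0∞) : ℕ → ℝ → V → V → ℝ≥0∞
  | 0, t, x, y => if x = y then ENNReal.ofReal (Real.exp (-(t * exitRate q x))) else 0
  | n + 1, t, x, y => ∫⁻ s in Ioc 0 t, ENNReal.ofReal (Real.exp (-(s * exitRate q x))) *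
      ∑' z, q x z * jumpProb q n (t - s) z y

/-- Transition probabilities of the minimal process, which dies after an explosion: the
probability of being at `y` at time `t` after finitely many jumps, starting from `x`. -/
def minimalTransition (q : V → V → ℝ≥0∞) (t : ℝ) (x y : V) : ℝ≥0∞ := ∑' n, jumpProb q n t x y

theorem jumpProb_equiv (e : V ≃ W) {q : V → V → ℝ≥0∞} {q' : W → W → ℝ≥0∞}
    (h : ∀ x y, q' (e x) (e y) = q x y) (n : ℕ) :
    ∀ t x y, jumpProb q' n t (e x) (e y) = jumpProb q n t x y := by
  have hexit : ∀ x, exitRate q' (e x) = exitRate q x := fun x => by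
    unfold exitRate
    rw [← e.tsum_eq]
    simp [h]
  induction n with
  | zero =>
    intro t x y
    by_cases hxy : x = y
    · subst hxy; simp [jumpProb, hexit]
    · have hxy' : e x ≠ e y := fun h' => hxy (e.injective h')
      simp [jumpProb, hxy, hxy']
  | succ n ih =>
    intro t x y
    simp only [jumpProb, hexit]
    refine lintegral_congr fun s => ?_
    rw [← e.tsum_eq]
    simp [h, ih]

theorem minimalTransition_equiv (e : V ≃ W) {q : V → V → ℝ≥0∞} {q' : W → W → ℝ≥0∞}
    (h : ∀ x y, q' (e x) (e y) = q x y) (t : ℝ) (x y : V) :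
    minimalTransition q' t (e x) (e y) = minimalTransition q t x y :=
  tsum_congr fun n => jumpProb_equiv e h n t x y

open Classical in
/-- The jump rate from `x` to `y ≠ x`: the sum of the weights of the edges joining `x` to `y`.
(Thus the Laplacian has entries `-rate x y` off the diagonal and zero row sums.) -/
def Network.rate (G : Network ℝ≥0) (x y : G.V) : ℝ≥0∞ :=
  if x = y then 0 else ∑' d : {d : G.D // G.src d = x ∧ G.dst d = y}, (G.emark d.1 : ℝ≥0∞)

theorem Network.rate_equiv {G H : Network ℝ≥0} (φ : Network.GraphIso G H) (hφ : φ.PreservesMarks)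
    (x y : G.V) : H.rate (φ.onV x) (φ.onV y) = G.rate x y := by
  unfold Network.rate
  by_cases hxy : x = y
  · subst hxy; simp
  have hxy' : φ.onV x ≠ φ.onV y := fun h' => hxy (φ.onV.injective h')
  rw [if_neg hxy, if_neg hxy']
  let e : {d : G.D // G.src d = x ∧ G.dst d = y} ≃
      {d : H.D // H.src d = φ.onV x ∧ H.dst d = φ.onV y} :=
    φ.onD.subtypeEquiv fun d => by simp [φ.map_src, φ.map_dst]
  rw [← e.tsum_eq]
  exact tsum_congr fun d => by simp [e, hφ.2]

end Walk

/-- The return probability `P_t(o, o)` of the (minimal) continuous-time random walk whose rates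
are the edge weights. -/
def returnProb (t : ℝ) : NetworkSpace ℝ≥0 1 → ℝ≥0∞ :=
  Quotient.lift (fun G => minimalTransition G.net.rate t (G.root 0) (G.root 0)) (by
    rintro G H ⟨φ, hm, hr⟩
    rw [← hr 0, minimalTransition_equiv φ.onV (Network.rate_equiv φ hm)])

end UnimodularNetwork

end

open UnimodularNetwork

noncomputable section

namespace UnimodularNetwork

open Filter Topology

/-! ### Beta integrals and power series -/

section Scalar

/-! By the Mass-Transport Principle, `X ↦ ∫ X(o,o) dν` is a trace on kernels that depend on the
network continuously. For bounded weights the expected return probability is the trace of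
`exp(-tL)`, and the Laplacian `L` grows as a quadratic form with the weights. The claim is then
monotonicity of a trace; it is proved here by nonnegative sums in `[0,∞]`, without operator theory.

Unbounded weights are truncated. With the cutoff `χ` at level `K` computed from the sum of both
weights, and `c = 2(K+1)`, let `X` be `χqχ` plus the diagonal `c - (exit rate of q)`. Thinned jumps
kill the walk, so it stays below the minimal process, while its `n`-jump part is eventually exact
for each `n` (`tendsto_truncTransition`). Uniformization (`tsum_killedJumpProb`) makes its
transition kernel a Poisson mixture of the powers of `X`. It therefore suffices that `Tr X'^n ≤ Tr
X^n` for the kernels `X'`, `X` of the larger and smaller weights.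

The factor 2 in `c` makes these kernels diagonally dominant, hence positive (`posForm_addDiag`). If
`C` satisfies `2 C(x,y) ≤ C(x,x) + C(y,y)`, mass transport along the added edge weight gives
`Tr(X'C) ≤ Tr(XC)` (`trace_kmul_walkKernel_mono`). Replacing factors one at a time is not enough,
since `X'^i X^j` need not be symmetric. Instead write `n = 2m + e` with `e < 2`: the sequence
`Tr(X'^(2(m-i)+e) X^(2i))` is convex in `i` by Cauchy–Schwarz, and its first increment is
nonnegative by the monotonicity above. Hence it increases up to `Tr(X'^e X^(2m))`, and one more use
of monotonicity removes an odd factor (`trace_kpow_walkKernel_le`).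

Measurability comes from continuity in the local topology (`LocalFn`); this is why the cutoff is a
continuous function of the exit rate and not an indicator. -/

theorem integral_pow_div_factorial_mul_sub_pow (t : ℝ) (j k : ℕ) :
    ∫ s in (0 : ℝ)..t, s ^ j / (j.factorial : ℝ) * ((t - s) ^ k / (k.factorial : ℝ)) =
      t ^ (j + k + 1) / ((j + k + 1).factorial : ℝ) := by
  have hder : ∀ k : ℕ, ∀ s : ℝ, HasDerivAt
      (fun s : ℝ => -((t - s) ^ (k + 1) / ((k + 1).factorial : ℝ)))
      ((t - s) ^ k / (k.factorial : ℝ)) s := by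
    intro k s
    have h := ((((hasDerivAt_id s).const_sub t).pow (k + 1)).div_const
      ((k + 1).factorial : ℝ)).neg
    refine h.congr_deriv ?_
    have : ((k : ℝ) + 1) ≠ 0 := by positivity
    have : (k.factorial : ℝ) ≠ 0 := by positivity
    simp only [id, Nat.factorial_succ, Nat.cast_mul, Nat.cast_add, Nat.cast_one,
      Nat.add_sub_cancel]
    field_simp
  have hder' : ∀ j : ℕ, ∀ s : ℝ, HasDerivAt
      (fun s : ℝ => s ^ (j + 1) / ((j + 1).factorial : ℝ)) (s ^ j / (j.factorial : ℝ)) s := by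
    intro j s
    have h := ((hasDerivAt_id s).pow (j + 1)).div_const ((j + 1).factorial : ℝ)
    refine h.congr_deriv ?_
    have : ((j : ℝ) + 1) ≠ 0 := by positivity
    have : (j.factorial : ℝ) ≠ 0 := by positivity
    simp only [id, Nat.factorial_succ, Nat.cast_mul, Nat.cast_add, Nat.cast_one,
      Nat.add_sub_cancel]
    field_simp
  induction j generalizing k with
  | zero =>
    simp only [pow_zero, Nat.factorial_zero, Nat.cast_one, div_one, one_mul, zero_add]
    rw [intervalIntegral.integral_eq_sub_of_hasDerivAt (fun s _ => hder k s)
      (by apply Continuous.intervalIntegrable; fun_prop)]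
    simp
  | succ j ih =>
    rw [intervalIntegral.integral_mul_deriv_eq_deriv_mul (fun s _ => hder' j s)
      (fun s _ => hder k s) (by apply Continuous.intervalIntegrable; fun_prop)
      (by apply Continuous.intervalIntegrable; fun_prop)]
    simp only [mul_neg, intervalIntegral.integral_neg, ih]
    rw [show j + (k + 1) + 1 = j + 1 + k + 1 by ring]
    simp

/-- This is the convolution over the first jump time: `j` holds, one jump and `k` later steps make
`j + k + 1` uniformized steps. -/
theorem lintegral_pow_div_factorial_mul_sub_pow {t : ℝ} (ht : 0 ≤ t) (j k : ℕ) :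
    ∫⁻ s in Ioc 0 t, ENNReal.ofReal (s ^ j / (j.factorial : ℝ)) *
        ENNReal.ofReal ((t - s) ^ k / (k.factorial : ℝ)) =
      ENNReal.ofReal (t ^ (j + k + 1) / ((j + k + 1).factorial : ℝ)) := by
  rw [← integral_pow_div_factorial_mul_sub_pow, intervalIntegral.integral_of_le ht,
    ofReal_integral_eq_lintegral_ofReal]
  · refine setLIntegral_congr_fun measurableSet_Ioc fun s hs => ?_
    have := hs.1.le
    exact (ENNReal.ofReal_mul (by positivity)).symm
  · rw [← IntegrableOn, ← intervalIntegrable_iff_integrableOn_Ioc_of_le ht]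
    apply Continuous.intervalIntegrable; fun_prop
  · refine (ae_restrict_iff' measurableSet_Ioc).2 (.of_forall fun s hs => ?_)
    have h1 := hs.1.le
    have h2 := sub_nonneg.2 hs.2
    show (0 : ℝ) ≤ _
    positivity

theorem ofReal_exp_mul (l : ℝ≥0) {s : ℝ} (hs : 0 ≤ s) :
    ENNReal.ofReal (Real.exp (l * s)) =
      ∑' j : ℕ, (l : ℝ≥0∞) ^ j * ENNReal.ofReal (s ^ j / (j.factorial : ℝ)) := by
  rw [Real.exp_eq_exp_ℝ, NormedSpace.exp_eq_tsum_div, ENNReal.ofReal_tsum_of_nonneg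
    (fun n => by positivity) (Real.summable_pow_div_factorial _)]
  refine tsum_congr fun j => ?_
  rw [mul_pow, mul_div_assoc, ENNReal.ofReal_mul (by positivity), ENNReal.ofReal_pow (by positivity),
    ENNReal.ofReal_coe_nnreal]

theorem lintegral_exp_mul_sub_pow (l : ℝ≥0) {t : ℝ} (ht : 0 ≤ t) (k : ℕ) :
    ∫⁻ s in Ioc 0 t, ENNReal.ofReal (Real.exp (l * s)) *
        ENNReal.ofReal ((t - s) ^ k / (k.factorial : ℝ)) =
      ∑' j : ℕ, (l : ℝ≥0∞) ^ j *
        ENNReal.ofReal (t ^ (j + k + 1) / ((j + k + 1).factorial : ℝ)) := by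
  rw [setLIntegral_congr_fun (g := fun s => ∑' j : ℕ, (l : ℝ≥0∞) ^ j *
    (ENNReal.ofReal (s ^ j / (j.factorial : ℝ)) *
      ENNReal.ofReal ((t - s) ^ k / (k.factorial : ℝ)))) measurableSet_Ioc, lintegral_tsum]
  · refine tsum_congr fun j => ?_
    rw [lintegral_const_mul _ (by fun_prop), lintegral_pow_div_factorial_mul_sub_pow ht]
  · intro j; fun_prop
  · intro s hs
    simp only [ofReal_exp_mul l hs.1.le, ← ENNReal.tsum_mul_right, mul_assoc]

theorem tsum_tsum_antidiagonal (f : ℕ → ℕ → ℝ≥0∞) :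
    ∑' k, ∑' j, f j k = ∑' n, ∑ p ∈ Finset.HasAntidiagonal.antidiagonal n, f p.1 p.2 := by
  rw [ENNReal.tsum_comm, ← ENNReal.tsum_prod,
    ← Finset.HasAntidiagonal.sigmaAntidiagonalEquivProd.tsum_eq, ENNReal.tsum_sigma']
  refine tsum_congr fun n => ?_
  rw [← Finset.tsum_subtype (Finset.HasAntidiagonal.antidiagonal n) (fun p => f p.1 p.2)]
  rfl

/-- Solution of the recursion `b (n + 1) = l * b n + a n`, `b 0 = 0`, in integrated form. -/
theorem tsum_lintegral_exp_mul_sub_pow (l : ℝ≥0) {t : ℝ} (ht : 0 ≤ t) (a b : ℕ → ℝ≥0∞)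
    (h0 : b 0 = 0) (hb : ∀ n, b (n + 1) = l * b n + a n) :
    ∑' k, a k * ∫⁻ s in Ioc 0 t, ENNReal.ofReal (Real.exp (l * s)) *
        ENNReal.ofReal ((t - s) ^ k / (k.factorial : ℝ)) =
      ∑' n, ENNReal.ofReal (t ^ n / (n.factorial : ℝ)) * b n := by
  -- Unrolling the recursion turns both sides into the same double series, summed along
  -- antidiagonals.
  have hsol : ∀ n, b (n + 1) = ∑ p ∈ Finset.HasAntidiagonal.antidiagonal n, (l : ℝ≥0∞) ^ p.1 * a p.2 := by
    intro n
    induction n with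
    | zero => simp [hb, h0]
    | succ n ih =>
      rw [hb, ih, Finset.Nat.antidiagonal_succ, Finset.sum_cons, Finset.sum_map, Finset.mul_sum,
        add_comm]
      simp [pow_succ', mul_assoc]
  simp only [lintegral_exp_mul_sub_pow l ht, ← ENNReal.tsum_mul_left]
  rw [tsum_tsum_antidiagonal fun j k => a k * ((l : ℝ≥0∞) ^ j *
        ENNReal.ofReal (t ^ (j + k + 1) / ((j + k + 1).factorial : ℝ))),
    tsum_eq_zero_add' (f := fun n => ENNReal.ofReal (t ^ n / (n.factorial : ℝ)) * b n)
      ENNReal.summable, h0, mul_zero, zero_add]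
  refine tsum_congr fun n => ?_
  rw [hsol, Finset.mul_sum]
  refine Finset.sum_congr rfl fun p hp => ?_
  rw [Finset.HasAntidiagonal.mem_antidiagonal.1 hp]
  ring

end Scalar

/-! ### Kernels and uniformization -/

section Kernel

variable {V : Type}

/-- Composition of nonnegative kernels. -/
def kmul (X Y : V → V → ℝ≥0∞) : V → V → ℝ≥0∞ := fun x y => ∑' z, X x z * Y z y

open Classical in
/-- The identity kernel. -/
def kone : V → V → ℝ≥0∞ := fun x y => if x = y then 1 else 0

/-- Powers of a kernel. -/
def kpow (X : V → V → ℝ≥0∞) : ℕ → V → V → ℝ≥0∞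
  | 0 => kone
  | n + 1 => kmul X (kpow X n)

theorem kmul_assoc (X Y Z : V → V → ℝ≥0∞) : kmul (kmul X Y) Z = kmul X (kmul Y Z) := by
  funext x y
  simp only [kmul, ← ENNReal.tsum_mul_right, ← ENNReal.tsum_mul_left]
  rw [ENNReal.tsum_comm]
  simp only [mul_assoc]

theorem kone_kmul (X : V → V → ℝ≥0∞) : kmul kone X = X := by
  funext x y
  rw [kmul, tsum_eq_single x fun z hz => by simp [kone, hz.symm]]
  simp [kone]

theorem kmul_kone (X : V → V → ℝ≥0∞) : kmul X kone = X := by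
  funext x y
  rw [kmul, tsum_eq_single y fun z hz => by simp [kone, hz]]
  simp [kone]

theorem kpow_add (X : V → V → ℝ≥0∞) (m n : ℕ) : kpow X (m + n) = kmul (kpow X m) (kpow X n) := by
  induction m with
  | zero => rw [zero_add, kpow, kone_kmul]
  | succ m ih => rw [Nat.succ_add, kpow, ih, kpow, kmul_assoc]

theorem kpow_one (X : V → V → ℝ≥0∞) : kpow X 1 = X := by rw [kpow, kpow, kmul_kone]

theorem tsum_kmul_le {X Y : V → V → ℝ≥0∞} {a b : ℝ≥0∞} (hX : ∀ x, ∑' y, X x y ≤ a)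
    (hY : ∀ x, ∑' y, Y x y ≤ b) (x : V) : ∑' y, kmul X Y x y ≤ a * b := by
  simp only [kmul]
  rw [ENNReal.tsum_comm]
  simp only [ENNReal.tsum_mul_left]
  calc ∑' z, X x z * ∑' y, Y z y ≤ ∑' z, X x z * b := by gcongr; exact hY _
    _ = (∑' z, X x z) * b := ENNReal.tsum_mul_right
    _ ≤ a * b := by gcongr; exact hX x

theorem tsum_kone (x : V) : ∑' y, (kone x y : ℝ≥0∞) = 1 := by
  rw [tsum_eq_single x fun y hy => by simp [kone, hy.symm]]
  simp [kone]

theorem tsum_kpow_le {X : V → V → ℝ≥0∞} {a : ℝ≥0∞} (hX : ∀ x, ∑' y, X x y ≤ a) (n : ℕ) (x : V) :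
    ∑' y, kpow X n x y ≤ a ^ n := by
  induction n generalizing x with
  | zero => simp [kpow, tsum_kone]
  | succ n ih => rw [pow_succ']; exact tsum_kmul_le hX ih x

/-- `jumpProb` with the exit rates decoupled from the jump rates. -/
def killedJumpProb (e : V → ℝ) (q : V → V → ℝ≥0∞) : ℕ → ℝ → V → V → ℝ≥0∞
  | 0, t, x, y => ENNReal.ofReal (Real.exp (-(t * e x))) * kone x y
  | n + 1, t, x, y => ∫⁻ s in Ioc 0 t, ENNReal.ofReal (Real.exp (-(s * e x))) *
      ∑' z, q x z * killedJumpProb e q n (t - s) z y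

theorem jumpProb_eq_killedJumpProb (q : V → V → ℝ≥0∞) (n : ℕ) (t : ℝ) (x y : V) :
    jumpProb q n t x y = killedJumpProb (exitRate q) q n t x y := by
  induction n generalizing t x y with
  | zero => by_cases h : x = y <;> simp [jumpProb, killedJumpProb, kone, h]
  | succ n ih => simp only [jumpProb, killedJumpProb, ih]

/-- The weight of the words with `n` jumps among `N` steps, each step being a jump with rates `q`
or a hold with rate `h`. -/
def jumpWords (h : V → ℝ≥0) (q : V → V → ℝ≥0∞) : ℕ → ℕ → V → V → ℝ≥0∞
  | 0, 0, x, y => kone x y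
  | _ + 1, 0, _, _ => 0
  | 0, N + 1, x, y => h x * jumpWords h q 0 N x y
  | n + 1, N + 1, x, y => h x * jumpWords h q (n + 1) N x y +
      ∑' z, q x z * jumpWords h q n N z y

/-- The kernel `q` with `h` added on the diagonal. -/
def addDiag (h : V → ℝ≥0) (q : V → V → ℝ≥0∞) : V → V → ℝ≥0∞ :=
  fun x y => q x y + h x * kone x y

theorem kmul_addDiag (h : V → ℝ≥0) (q X : V → V → ℝ≥0∞) (x y : V) :
    kmul (addDiag h q) X x y = ∑' z, q x z * X z y + h x * X x y := by
  simp only [kmul, addDiag, add_mul]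
  rw [ENNReal.tsum_add]
  congr 1
  rw [tsum_eq_single x fun z hz => by simp [kone, hz.symm]]
  simp [kone]

/-- Expand the power of `q + diag h` into words of jumps and holds, and sort the words by their
number of jumps. -/
theorem tsum_jumpWords (h : V → ℝ≥0) (q : V → V → ℝ≥0∞) (N : ℕ) (x y : V) :
    ∑' n, jumpWords h q n N x y = kpow (addDiag h q) N x y := by
  induction N generalizing x y with
  | zero =>
    rw [tsum_eq_single 0]
    · simp [jumpWords, kpow]
    · rintro (_ | n) hn
      · exact absurd rfl hn
      · simp [jumpWords]
  | succ N ih =>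
    rw [kpow, kmul_addDiag, tsum_eq_zero_add' ENNReal.summable]
    simp only [jumpWords]
    rw [ENNReal.tsum_add, ENNReal.tsum_comm]
    simp only [ENNReal.tsum_mul_left, ih]
    rw [← add_assoc, ← mul_add, ← tsum_eq_zero_add' (f := fun n => jumpWords h q n N x y)
      ENNReal.summable, ih, add_comm]

/-- Since `e x = c - h x`, a factor `exp(-cs)` comes out of every holding time. The remaining `exp(h
x * s)` expands into hold steps, and integrating over the first jump time reproduces the recursion
of `jumpWords`. -/
theorem killedJumpProb_eq_tsum {c : ℝ} {e : V → ℝ} {h : V → ℝ≥0} (hc : ∀ x, e x + h x = c)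
    (q : V → V → ℝ≥0∞) (n : ℕ) {t : ℝ} (ht : 0 ≤ t) (x y : V) :
    killedJumpProb e q n t x y = ENNReal.ofReal (Real.exp (-(c * t))) *
      ∑' N, ENNReal.ofReal (t ^ N / (N.factorial : ℝ)) * jumpWords h q n N x y := by
  have hexp : ∀ x, ∀ s r : ℝ, ENNReal.ofReal (Real.exp (-(s * e x))) *
      ENNReal.ofReal (Real.exp (-(c * r))) = ENNReal.ofReal (Real.exp (-(c * (s + r)))) *
        ENNReal.ofReal (Real.exp (h x * s)) := fun x s r => by
    rw [← ENNReal.ofReal_mul (Real.exp_nonneg _), ← ENNReal.ofReal_mul (Real.exp_nonneg _),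
      ← Real.exp_add, ← Real.exp_add, ← hc x]
    ring_nf
  induction n generalizing t x y with
  | zero =>
    have hw : ∀ N, jumpWords h q 0 N x y = (h x : ℝ≥0∞) ^ N * kone x y := fun N => by
      induction N with
      | zero => simp [jumpWords]
      | succ N ih => rw [jumpWords, ih, pow_succ', mul_assoc]
    have h1 := hexp x t 0
    simp only [mul_zero, neg_zero, Real.exp_zero, ENNReal.ofReal_one, mul_one, add_zero] at h1
    rw [killedJumpProb, h1, ofReal_exp_mul _ ht, mul_assoc, ← ENNReal.tsum_mul_right]
    simp only [hw]
    congr 1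
    exact tsum_congr fun N => by ring
  | succ n ih =>
    rw [← tsum_lintegral_exp_mul_sub_pow (h x) ht (fun N => ∑' z, q x z * jumpWords h q n N z y)
      (fun N => jumpWords h q (n + 1) N x y) rfl fun N => rfl, killedJumpProb,
      ← ENNReal.tsum_mul_left]
    rw [setLIntegral_congr_fun (g := fun s => ∑' N, ENNReal.ofReal (Real.exp (-(c * t))) *
      ((∑' z, q x z * jumpWords h q n N z y) * (ENNReal.ofReal (Real.exp (h x * s)) *
        ENNReal.ofReal ((t - s) ^ N / (N.factorial : ℝ))))) measurableSet_Ioc, lintegral_tsum]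
    · refine tsum_congr fun N => ?_
      rw [lintegral_const_mul _ (by fun_prop), lintegral_const_mul _ (by fun_prop)]
    · intro N; fun_prop
    · intro s hs
      have hts := sub_nonneg.2 hs.2
      simp only [ih hts, ← ENNReal.tsum_mul_left, ← ENNReal.tsum_mul_right]
      rw [ENNReal.tsum_comm]
      refine tsum_congr fun N => tsum_congr fun z => ?_
      have h1 := hexp x s (t - s)
      rw [add_sub_cancel] at h1
      calc _ = (ENNReal.ofReal (Real.exp (-(s * e x))) *
            ENNReal.ofReal (Real.exp (-(c * (t - s))))) * (q x z *
              (ENNReal.ofReal ((t - s) ^ N / (N.factorial : ℝ)) * jumpWords h q n N z y)) := by ring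
        _ = _ := by rw [h1]; ring

/-- Uniformization: the transition kernel is a Poisson mixture of powers of `addDiag h q`. -/
theorem tsum_killedJumpProb {c : ℝ} {e : V → ℝ} {h : V → ℝ≥0} (hc : ∀ x, e x + h x = c)
    (q : V → V → ℝ≥0∞) {t : ℝ} (ht : 0 ≤ t) (x y : V) :
    ∑' n, killedJumpProb e q n t x y = ENNReal.ofReal (Real.exp (-(c * t))) *
      ∑' N, ENNReal.ofReal (t ^ N / (N.factorial : ℝ)) * kpow (addDiag h q) N x y := by
  simp only [killedJumpProb_eq_tsum hc q _ ht, ENNReal.tsum_mul_left]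
  rw [ENNReal.tsum_comm]
  simp only [ENNReal.tsum_mul_left, tsum_jumpWords]

/-- Row sums of the `N`-th power are at most `c ^ N`, so the Poisson series has total mass at most
one. This is the dominating bound for the limit in `K`. -/
theorem poisson_mixture_le_one {c : ℝ≥0} {X : V → V → ℝ≥0∞} (hX : ∀ x, ∑' y, X x y ≤ c)
    {t : ℝ} (ht : 0 ≤ t) (x y : V) : ENNReal.ofReal (Real.exp (-(c * t))) *
      ∑' N, ENNReal.ofReal (t ^ N / (N.factorial : ℝ)) * kpow X N x y ≤ 1 := by
  calc _ ≤ ENNReal.ofReal (Real.exp (-(c * t))) *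
        ∑' N : ℕ, (c : ℝ≥0∞) ^ N * ENNReal.ofReal (t ^ N / (N.factorial : ℝ)) := by
        refine mul_le_mul_right (ENNReal.tsum_le_tsum fun N => ?_) _
        rw [mul_comm]
        refine mul_le_mul_left ?_ _
        exact (ENNReal.le_tsum y).trans (tsum_kpow_le hX N x)
    _ = 1 := by
        rw [← ofReal_exp_mul c ht, ← ENNReal.ofReal_mul (Real.exp_nonneg _), ← Real.exp_add]
        simp

end Kernel

/-! ### Truncation and convergence to the minimal process -/

section Truncation

variable {V : Type}

/-- The chain with jump rates `q` uniformized at rate `c`, after jumps have been thinned by the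
cutoff `χ` at both ends: `χ q χ` plus the diagonal `c - exitRate q` (truncated at `0`). -/
def truncKernel (χ : V → ℝ≥0∞) (c : ℝ≥0) (q : V → V → ℝ≥0∞) : V → V → ℝ≥0∞ :=
  addDiag (fun x => c - (∑' z, q x z).toNNReal) (fun x y => χ x * q x y * χ y)

theorem tsum_thinned_le {χ : V → ℝ≥0∞} (hχ : ∀ x, χ x ≤ 1) (q : V → V → ℝ≥0∞) (x : V) :
    ∑' y, χ x * q x y * χ y ≤ ∑' y, q x y :=
  ENNReal.tsum_le_tsum fun y => by
    calc χ x * q x y * χ y ≤ 1 * q x y * 1 := by gcongr <;> exact hχ _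
      _ = q x y := by ring

theorem thinned_eq_zero {χ : V → ℝ≥0∞} (q : V → V → ℝ≥0∞) {x : V} (hx : χ x = 0) :
    ∑' y, χ x * q x y * χ y = 0 := by simp [hx]

/-- Where `χ` vanishes only the diagonal is left. Elsewhere the subtraction from `c` is genuine and
thinning only lowers the off-diagonal part. -/
theorem tsum_truncKernel_le {χ : V → ℝ≥0∞} {c : ℝ≥0} {q : V → V → ℝ≥0∞} (hχ : ∀ x, χ x ≤ 1)
    (hc : ∀ x, χ x ≠ 0 → ∑' z, q x z ≤ c) (x : V) : ∑' y, truncKernel χ c q x y ≤ c := by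
  simp only [truncKernel, addDiag]
  rw [ENNReal.tsum_add, ENNReal.tsum_mul_left, tsum_kone, mul_one]
  by_cases hx : χ x = 0
  · rw [thinned_eq_zero q hx, zero_add]
    exact_mod_cast tsub_le_self
  · have h1 := hc x hx
    have hfin : ∑' z, q x z ≠ ∞ := ne_top_of_le_ne_top ENNReal.coe_ne_top h1
    rw [ENNReal.coe_sub, ENNReal.coe_toNNReal hfin]
    calc _ ≤ ∑' y, q x y + (c - ∑' z, q x z) := by exact add_le_add_left (tsum_thinned_le hχ q x) _
      _ = c := add_tsub_cancel_of_le h1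

/-- Paths charged by `q'` and started in `S` never leave `S`, so only holding rates in `S` matter.
Outside the support of the cutoff the uniformized exit rate may differ from the true one. -/
theorem killedJumpProb_mono {e e' : V → ℝ} {q q' : V → V → ℝ≥0∞} (hq : ∀ x y, q' x y ≤ q x y)
    {S : Set V} (hS : ∀ x y, q' x y ≠ 0 → y ∈ S) (he : ∀ x ∈ S, e' x = e x) (n : ℕ) (t : ℝ)
    {x : V} (hx : x ∈ S) (y : V) : killedJumpProb e' q' n t x y ≤ killedJumpProb e q n t x y := by
  induction n generalizing t x with
  | zero => simp only [killedJumpProb, he x hx, le_refl]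
  | succ n ih =>
    simp only [killedJumpProb, he x hx]
    refine lintegral_mono fun s => ?_
    refine mul_le_mul_right (ENNReal.tsum_le_tsum fun z => ?_) _
    by_cases hz : q' x z = 0
    · simp [hz]
    · exact mul_le_mul' (hq x z) (ih _ (hS x z hz))

/-- Finitely many vertices are reachable in `n` jumps, so for a fixed `n` all relevant rates have
stabilized once `K` is large. -/
theorem eventually_killedJumpProb_eq {e : V → ℝ} {e' : ℕ → V → ℝ} {q : V → V → ℝ≥0∞}
    {q' : ℕ → V → V → ℝ≥0∞} (hfin : ∀ x, {z | q x z ≠ 0}.Finite)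
    (hq : ∀ x y, ∀ᶠ K in atTop, q' K x y = q x y) (hle : ∀ K x y, q' K x y ≤ q x y)
    (he : ∀ x, ∀ᶠ K in atTop, e' K x = e x) (n : ℕ) (x : V) :
    ∀ᶠ K in atTop, ∀ t y, killedJumpProb (e' K) (q' K) n t x y = killedJumpProb e q n t x y := by
  induction n generalizing x with
  | zero =>
    filter_upwards [he x] with K hK t y
    simp only [killedJumpProb, hK]
  | succ n ih =>
    have h1 : ∀ᶠ K in atTop, ∀ z ∈ {z | q x z ≠ 0}, q' K x z = q x z ∧
        ∀ t y, killedJumpProb (e' K) (q' K) n t z y = killedJumpProb e q n t z y :=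
      (eventually_all_finite (hfin x)).2 fun z _ => (hq x z).and (ih z)
    filter_upwards [he x, h1] with K hK hK' t y
    simp only [killedJumpProb, hK]
    refine lintegral_congr fun s => ?_
    congr 1
    refine tsum_congr fun z => ?_
    by_cases hz : q x z = 0
    · have := hle K x z
      rw [hz, nonpos_iff_eq_zero] at this
      rw [this, hz, zero_mul, zero_mul]
    · rw [(hK' z hz).1, (hK' z hz).2]

/-- The truncated and uniformized approximation of the minimal transition probabilities. -/
def truncTransition (χ : V → ℝ≥0∞) (c : ℝ≥0) (q : V → V → ℝ≥0∞) (t : ℝ) (x y : V) : ℝ≥0∞ :=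
  ENNReal.ofReal (Real.exp (-(c * t))) *
    ∑' N, ENNReal.ofReal (t ^ N / (N.factorial : ℝ)) * kpow (truncKernel χ c q) N x y

/-- The diagonal subtracts the full exit rate and not the thinned one, so a thinned jump is a death.
This bounds the approximations by the minimal process; stabilization of finitely many jump numbers
gives the matching lower bound. -/
theorem tendsto_truncTransition {χ : ℕ → V → ℝ≥0∞} {c : ℕ → ℝ≥0} {q : V → V → ℝ≥0∞}
    (hχ : ∀ K x, χ K x ≤ 1) (hχ1 : ∀ x, ∀ᶠ K in atTop, χ K x = 1)
    (hc : ∀ K x, χ K x ≠ 0 → ∑' z, q x z ≤ c K) (hfin : ∀ x, {z | q x z ≠ 0}.Finite)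
    {t : ℝ} (ht : 0 ≤ t) (x y : V) :
    Tendsto (fun K => truncTransition (χ K) (c K) q t x y) atTop
      (𝓝 (minimalTransition q t x y)) := by
  set h : ℕ → V → ℝ≥0 := fun K x => c K - (∑' z, q x z).toNNReal with hh
  set e' : ℕ → V → ℝ := fun K x => c K - h K x with he'
  set q' : ℕ → V → V → ℝ≥0∞ := fun K x y => χ K x * q x y * χ K y with hq'
  have hW : ∀ K, truncTransition (χ K) (c K) q t x y =
      ∑' n, killedJumpProb (e' K) (q' K) n t x y := fun K => by
    rw [tsum_killedJumpProb (c := c K) (h := h K) (fun x => by simp [he']) (q' K) ht]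
    rfl
  have hee : ∀ K x, χ K x ≠ 0 → e' K x = exitRate q x := fun K x hx => by
    have h1 := hc K x hx
    have h2 : (∑' z, q x z).toNNReal ≤ c K := by
      rw [← ENNReal.toNNReal_coe (c K)]
      exact ENNReal.toNNReal_mono ENNReal.coe_ne_top h1
    simp only [he', hh]
    rw [NNReal.coe_sub h2, sub_sub_cancel]
    rfl
  have hle : ∀ K x y, q' K x y ≤ q x y := fun K x y => by
    calc χ K x * q x y * χ K y ≤ 1 * q x y * 1 := by gcongr <;> exact hχ _ _
      _ = q x y := by ring
  have hP : minimalTransition q t x y = ∑' n, killedJumpProb (exitRate q) q n t x y :=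
    tsum_congr fun n => jumpProb_eq_killedJumpProb q n t x y
  simp only [hW, hP]
  rw [tendsto_order]
  constructor
  · intro a ha
    rw [ENNReal.tsum_eq_iSup_nat, lt_iSup_iff] at ha
    obtain ⟨N, hN⟩ := ha
    have h1 : ∀ᶠ K in atTop, ∀ n ∈ Finset.range N, ∀ t y,
        killedJumpProb (e' K) (q' K) n t x y = killedJumpProb (exitRate q) q n t x y := by
      refine (Filter.eventually_all_finset _).2 fun n _ => ?_
      refine eventually_killedJumpProb_eq hfin (fun x y => ?_) hle (fun x => ?_) n x
      · filter_upwards [hχ1 x, hχ1 y] with K hx hy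
        simp [hq', hx, hy]
      · filter_upwards [hχ1 x] with K hx
        exact hee K x (by simp [hx])
    filter_upwards [h1] with K hK
    refine hN.trans_le ?_
    rw [← Finset.sum_congr rfl fun n hn => hK n hn t y]
    exact ENNReal.sum_le_tsum _
  · intro a ha
    filter_upwards [hχ1 x] with K hx
    refine lt_of_le_of_lt (ENNReal.tsum_le_tsum fun n => ?_) ha
    refine killedJumpProb_mono (hle K) (S := {x | χ K x ≠ 0}) (fun x y h0 => ?_)
      (fun x hx => hee K x hx) n t (by simp [hx]) y
    exact fun h1 => h0 (by simp [hq', h1])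

end Truncation

/-! ### Jump rates from edge weights, and their cutoff -/

namespace Network

variable {Ξ : Type}

open Classical in
/-- The jump rates when an edge with mark `m` has weight `ψ m`. -/
def weightRate (ψ : Ξ → ℝ≥0) (G : Network Ξ) (x y : G.V) : ℝ≥0∞ :=
  if x = y then 0 else ∑' d : {d : G.D // G.src d = x ∧ G.dst d = y}, (ψ (G.emark d.1) : ℝ≥0∞)

theorem weightRate_self (ψ : Ξ → ℝ≥0) (G : Network Ξ) (x : G.V) : G.weightRate ψ x x = 0 :=
  if_pos rfl

theorem weightRate_of_ne (ψ : Ξ → ℝ≥0) (G : Network Ξ) {x y : G.V} (h : x ≠ y) :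
    G.weightRate ψ x y =
      ∑' d : {d : G.D // G.src d = x ∧ G.dst d = y}, (ψ (G.emark d.1) : ℝ≥0∞) :=
  if_neg h

open Classical in
-- Grouping the oriented edges at `x` by their endpoint replaces a sum over all vertices by a finite
-- sum over edges in the locally finite case. Ball isomorphisms can match such sums term by term;
-- loops contribute zero.
theorem tsum_weightRate_mul (ψ : Ξ → ℝ≥0) (G : Network Ξ) (x : G.V) (g : G.V → ℝ≥0∞) :
    ∑' z, G.weightRate ψ x z * g z = ∑' d : {d : G.D // G.src d = x},
      (ψ (G.emark d.1) : ℝ≥0∞) * (if x = G.dst d.1 then 0 else g (G.dst d.1)) := by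
  have h1 : ∀ z, G.weightRate ψ x z * g z =
      ∑' d : {d : {d : G.D // G.src d = x} // G.dst d.1 = z},
        (ψ (G.emark d.1.1) : ℝ≥0∞) * (if x = G.dst d.1.1 then 0 else g (G.dst d.1.1)) := by
    intro z
    by_cases hxz : x = z
    · subst hxz
      rw [weightRate_self, zero_mul, eq_comm, ENNReal.tsum_eq_zero]
      intro d
      rw [if_pos d.2.symm, mul_zero]
    · rw [weightRate_of_ne ψ G hxz, ← ENNReal.tsum_mul_right]
      let e : {d : G.D // G.src d = x ∧ G.dst d = z} ≃
          {d : {d : G.D // G.src d = x} // G.dst d.1 = z} :=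
        (Equiv.subtypeSubtypeEquivSubtypeInter _ _).symm
      rw [← e.tsum_eq]
      refine tsum_congr fun d => ?_
      have h2 : G.dst (e d).1.1 = z := (e d).2
      rw [h2, if_neg hxz]
      rfl
  simp only [h1]
  rw [← (Equiv.sigmaFiberEquiv fun d : {d : G.D // G.src d = x} => G.dst d.1).tsum_eq,
    ENNReal.tsum_sigma']
  rfl

theorem tsum_weightRate (ψ : Ξ → ℝ≥0) (G : Network Ξ) (x : G.V) :
    ∑' z, G.weightRate ψ x z = ∑' d : {d : G.D // G.src d = x},
      (ψ (G.emark d.1) : ℝ≥0∞) * (1 - kone x (G.dst d.1)) := by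
  rw [← tsum_congr fun z => mul_one (G.weightRate ψ x z), tsum_weightRate_mul ψ G x fun _ => 1]
  refine tsum_congr fun d => ?_
  by_cases h : x = G.dst d.1 <;> simp [kone, h]

theorem weightRate_ne_zero {ψ : Ξ → ℝ≥0} {G : Network Ξ} {x z : G.V}
    (h : G.weightRate ψ x z ≠ 0) : ∃ d, G.src d = x ∧ G.dst d = z := by
  classical
  by_contra hne
  push Not at hne
  apply h
  unfold weightRate
  split_ifs
  · rfl
  · exact ENNReal.tsum_eq_zero.2 fun d => absurd d.2.2 (hne _ d.2.1)

theorem finite_weightRate_ne_zero (ψ : Ξ → ℝ≥0) {G : Network Ξ} (hG : G.LocallyFinite) (x : G.V) :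
    {z | G.weightRate ψ x z ≠ 0}.Finite :=
  ((hG x).image G.dst).subset fun _ hz =>
    let ⟨d, h1, h2⟩ := weightRate_ne_zero hz
    ⟨d, h1, h2⟩

theorem tsum_weightRate_ne_top (ψ : Ξ → ℝ≥0) {G : Network Ξ} (hG : G.LocallyFinite) (x : G.V) :
    ∑' z, G.weightRate ψ x z ≠ ∞ := by
  have : Finite {d : G.D // G.src d = x} := hG x
  have := Fintype.ofFinite {d : G.D // G.src d = x}
  rw [tsum_weightRate, tsum_fintype]
  refine ENNReal.sum_ne_top.2 fun d _ => ENNReal.mul_ne_top ENNReal.coe_ne_top ?_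
  exact ne_top_of_le_ne_top ENNReal.one_ne_top tsub_le_self

theorem weightRate_mono {ψ η : Ξ → ℝ≥0} (h : ∀ m, ψ m ≤ η m) (G : Network Ξ) (x y : G.V) :
    G.weightRate ψ x y ≤ G.weightRate η x y := by
  rcases eq_or_ne x y with rfl | hxy
  · rw [weightRate_self, weightRate_self]
  · rw [weightRate_of_ne _ G hxy, weightRate_of_ne _ G hxy]
    exact ENNReal.tsum_le_tsum fun d => by exact_mod_cast h _

theorem weightRate_add {ψ η θ : Ξ → ℝ≥0} (G : Network Ξ)
    (h : ∀ d, θ (G.emark d) = ψ (G.emark d) + η (G.emark d)) (x y : G.V) :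
    G.weightRate θ x y = G.weightRate ψ x y + G.weightRate η x y := by
  rcases eq_or_ne x y with rfl | hxy
  · simp only [weightRate_self, add_zero]
  · rw [weightRate_of_ne _ G hxy, weightRate_of_ne _ G hxy, weightRate_of_ne _ G hxy, ← ENNReal.tsum_add]
    exact tsum_congr fun d => by exact_mod_cast h _

theorem weightRate_symm {ψ : Ξ → ℝ≥0} {G : Network Ξ}
    (h : ∀ d, ψ (G.emark (G.rev d)) = ψ (G.emark d)) (x y : G.V) :
    G.weightRate ψ x y = G.weightRate ψ y x := by
  rcases eq_or_ne x y with rfl | hxy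
  · rfl
  · rw [weightRate_of_ne _ G hxy, weightRate_of_ne _ G hxy.symm]
    let r : G.D ≃ G.D := ⟨G.rev, G.rev, G.rev_rev, G.rev_rev⟩
    let e : {d : G.D // G.src d = x ∧ G.dst d = y} ≃ {d : G.D // G.src d = y ∧ G.dst d = x} :=
      r.subtypeEquiv fun d => by simp [r, dst, G.rev_rev, and_comm]
    refine Eq.trans ?_ (e.tsum_eq fun d => ((ψ (G.emark d.1) : ℝ≥0) : ℝ≥0∞))
    exact tsum_congr fun d => congrArg _ (h d.1).symm

/-- A cutoff: `1` where the exit rate for the weight `η` is at most `K`, and `0` where it is at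
least `K + 1`. -/
def cutoff (η : Ξ → ℝ≥0) (K : ℕ) (G : Network Ξ) (x : G.V) : ℝ≥0∞ :=
  min 1 ((K + 1 : ℕ) - ∑' z, G.weightRate η x z)

/-- The uniformization rate that goes with `cutoff η K`. -/
def cutoffRate (K : ℕ) : ℝ≥0 := 2 * (K + 1 : ℕ)

theorem cutoff_le_one (η : Ξ → ℝ≥0) (K : ℕ) (G : Network Ξ) (x : G.V) : G.cutoff η K x ≤ 1 :=
  min_le_left _ _

theorem tsum_weightRate_le_of_cutoff_ne_zero {η : Ξ → ℝ≥0} {K : ℕ} {G : Network Ξ} {x : G.V}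
    (h : G.cutoff η K x ≠ 0) : ∑' z, G.weightRate η x z ≤ (K + 1 : ℕ) := by
  by_contra hlt
  exact h (by rw [cutoff, tsub_eq_zero_of_le (not_le.1 hlt).le]; simp)

theorem two_mul_tsum_weightRate_le_of_cutoff_ne_zero {ψ η : Ξ → ℝ≥0} (hψ : ∀ m, ψ m ≤ η m) {K : ℕ}
    {G : Network Ξ} {x : G.V} (h : G.cutoff η K x ≠ 0) :
    2 * ∑' z, G.weightRate ψ x z ≤ cutoffRate K := by
  rw [cutoffRate, ENNReal.coe_mul]
  refine mul_le_mul' le_rfl ?_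
  exact (ENNReal.tsum_le_tsum fun z => weightRate_mono hψ G x z).trans
    (by exact_mod_cast tsum_weightRate_le_of_cutoff_ne_zero h)

theorem tsum_weightRate_le_cutoffRate {ψ η : Ξ → ℝ≥0} (hψ : ∀ m, ψ m ≤ η m) {K : ℕ}
    {G : Network Ξ} {x : G.V} (h : G.cutoff η K x ≠ 0) :
    ∑' z, G.weightRate ψ x z ≤ cutoffRate K :=
  (le_mul_of_one_le_left zero_le one_le_two).trans
    (two_mul_tsum_weightRate_le_of_cutoff_ne_zero hψ h)

theorem eventually_cutoff_eq_one (η : Ξ → ℝ≥0) {G : Network Ξ} (hG : G.LocallyFinite) (x : G.V) :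
    ∀ᶠ K in atTop, G.cutoff η K x = 1 := by
  obtain ⟨N, hN⟩ := ENNReal.exists_nat_gt (tsum_weightRate_ne_top η hG x)
  filter_upwards [eventually_ge_atTop N] with K hK
  refine min_eq_left (ENNReal.le_sub_of_add_le_left (tsum_weightRate_ne_top η hG x) ?_)
  rw [Nat.cast_add, Nat.cast_one]
  gcongr
  exact hN.le.trans (by exact_mod_cast hK)

/-- The truncated uniformized kernel of the walk with edge weights `ψ`, cut off by `η`. -/
def walkKernel (ψ η : Ξ → ℝ≥0) (K : ℕ) (G : Network Ξ) : G.V → G.V → ℝ≥0∞ :=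
  truncKernel (G.cutoff η K) (cutoffRate K) (G.weightRate ψ)

theorem tendsto_truncTransition {ψ η : Ξ → ℝ≥0} (hψ : ∀ m, ψ m ≤ η m) {G : Network Ξ}
    (hG : G.LocallyFinite) {t : ℝ} (ht : 0 ≤ t) (x y : G.V) :
    Tendsto (fun K => truncTransition (G.cutoff η K) (cutoffRate K) (G.weightRate ψ) t x y) atTop
      (𝓝 (minimalTransition (G.mapMarks ψ).rate t x y)) :=
  UnimodularNetwork.tendsto_truncTransition (fun K => cutoff_le_one η K G)
    (eventually_cutoff_eq_one η hG) (fun _ _ => tsum_weightRate_le_cutoffRate hψ)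
    (finite_weightRate_ne_zero ψ hG) ht x y

end Network

/-! ### Bounded paths and isomorphisms of induced subnetworks -/

namespace Network

variable {Ξ Ξ' : Type}

/-- `y` can be reached from `x` along a path of at most `n` edges. -/
def Within (G : Network Ξ) : ℕ → G.V → G.V → Prop
  | 0, x, y => x = y
  | n + 1, x, y => G.Within n x y ∨ ∃ d, G.src d = x ∧ G.Within n (G.dst d) y

theorem within_refl (G : Network Ξ) (n : ℕ) (x : G.V) : G.Within n x x := by
  induction n with
  | zero => rfl
  | succ n ih => exact Or.inl ih

theorem Within.mono {G : Network Ξ} {m n : ℕ} (h : m ≤ n) {x y : G.V} (hxy : G.Within m x y) :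
    G.Within n x y := by
  induction h with
  | refl => exact hxy
  | step _ ih => exact Or.inl ih

theorem within_one (G : Network Ξ) (d : G.D) : G.Within 1 (G.src d) (G.dst d) :=
  Or.inr ⟨d, rfl, rfl⟩

theorem Within.trans {G : Network Ξ} {m n : ℕ} {x y z : G.V} (hxy : G.Within m x y)
    (hyz : G.Within n y z) : G.Within (m + n) x z := by
  induction m generalizing x with
  | zero => cases hxy; rwa [zero_add]
  | succ m ih =>
    rw [Nat.succ_add]
    rcases hxy with h | ⟨d, hd, h⟩
    · exact Or.inl (ih h)
    · exact Or.inr ⟨d, hd, ih h⟩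

theorem within_of_walk {G : Network Ξ} {x y : G.V} (w : G.simpleGraph.Walk x y) :
    G.Within w.length x y := by
  induction w with
  | nil => rfl
  | @cons x y z h w ih =>
    rw [SimpleGraph.Walk.length_cons]
    rcases h.2 with ⟨d, h1, h2⟩ | ⟨d, h1, h2⟩
    · exact Or.inr ⟨d, h1, by rwa [h2]⟩
    · refine Or.inr ⟨G.rev d, h2, ?_⟩
      rwa [dst, G.rev_rev, h1]

/-- The recursive path relation passes through isomorphisms and induced subnetworks by induction,
which avoids comparing graph distances inside and outside a ball. -/
theorem dist_le_iff_within {G : Network Ξ} (hG : G.simpleGraph.Connected) {n : ℕ} {x y : G.V} :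
    G.simpleGraph.dist x y ≤ n ↔ G.Within n x y := by
  constructor
  · intro h
    obtain ⟨w, hw⟩ := hG.exists_walk_length_eq_dist x y
    exact (within_of_walk w).mono (hw ▸ h)
  · intro h
    induction n generalizing x with
    | zero => cases h; simp
    | succ n ih =>
      rcases h with h | ⟨d, rfl, h⟩
      · exact (ih h).trans n.le_succ
      · have h1 : G.simpleGraph.dist (G.src d) (G.dst d) ≤ 1 := by
          by_cases hne : G.src d = G.dst d
          · rw [← hne]; simp
          · have hadj : G.simpleGraph.Adj (G.src d) (G.dst d) := ⟨hne, Or.inl ⟨d, rfl, rfl⟩⟩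
            exact (SimpleGraph.dist_eq_one_iff_adj.2 hadj).le
        have h2 := hG.dist_triangle (u := G.src d) (v := G.dst d) (w := y)
        have h3 := ih h
        omega

theorem GraphIso.within {G : Network Ξ} {H : Network Ξ'} (φ : GraphIso G H) {n : ℕ} {x y : G.V}
    (h : G.Within n x y) : H.Within n (φ.onV x) (φ.onV y) := by
  induction n generalizing x with
  | zero => exact congrArg φ.onV h
  | succ n ih =>
    rcases h with h | ⟨d, rfl, h⟩
    · exact Or.inl (ih h)
    · exact Or.inr ⟨φ.onD d, φ.map_src d, by rw [φ.map_dst]; exact ih h⟩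

theorem GraphIso.within_iff {G : Network Ξ} {H : Network Ξ'} (φ : GraphIso G H) {n : ℕ}
    {x y : G.V} : H.Within n (φ.onV x) (φ.onV y) ↔ G.Within n x y :=
  ⟨fun h => by
    have h1 : G.Within n (φ.onV.symm (φ.onV x)) (φ.onV.symm (φ.onV y)) := φ.symm.within h
    rwa [Equiv.symm_apply_apply, Equiv.symm_apply_apply] at h1, φ.within⟩

theorem Within.of_induce {G : Network Ξ} {A : Set G.V} {n : ℕ} {x y : A}
    (h : (G.induce A).Within n x y) : G.Within n x.1 y.1 := by
  induction n generalizing x with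
  | zero => exact congrArg Subtype.val h
  | succ n ih =>
    rcases h with h | ⟨d, hd, h⟩
    · exact Or.inl (ih h)
    · exact Or.inr ⟨d.1, congrArg Subtype.val hd, ih h⟩

/-- Each vertex on a path of at most `n` edges from `x` is itself within `n` of `x`, so `hA` keeps
the whole path inside `A`. -/
theorem Within.induce {G : Network Ξ} {A : Set G.V} {n : ℕ} {x y : A}
    (hA : ∀ z, G.Within n x.1 z → z ∈ A) (h : G.Within n x.1 y.1) :
    (G.induce A).Within n x y := by
  induction n generalizing x with
  | zero => exact Subtype.ext h
  | succ n ih =>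
    rcases h with h | ⟨d, hd, h⟩
    · exact Or.inl (ih (fun z hz => hA z (Or.inl hz)) h)
    · have hdst : G.dst d ∈ A := hA _ (Or.inr ⟨d, hd, G.within_refl n _⟩)
      refine Or.inr ⟨⟨d, hd ▸ x.2, hdst⟩, Subtype.ext hd, ?_⟩
      exact ih (x := ⟨G.dst d, hdst⟩) (fun z hz => hA z (Or.inr ⟨d, hd, hz⟩)) h

section Induce

variable {G : Network Ξ} {H : Network Ξ'} {A A' : Set G.V} {B B' : Set H.V}

/-- The vertex map of an isomorphism of induced subnetworks. -/
def GraphIso.subV (φ : GraphIso (G.induce A) (H.induce B)) : A ≃ B := φ.onV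

/-- The edge map of an isomorphism of induced subnetworks. -/
def GraphIso.subD (φ : GraphIso (G.induce A) (H.induce B)) :
    {d // G.src d ∈ A ∧ G.dst d ∈ A} ≃ {d // H.src d ∈ B ∧ H.dst d ∈ B} := φ.onD

theorem GraphIso.src_subD (φ : GraphIso (G.induce A) (H.induce B))
    (d : {d // G.src d ∈ A ∧ G.dst d ∈ A}) :
    H.src (φ.subD d).1 = (φ.subV ⟨G.src d.1, d.2.1⟩).1 := congrArg Subtype.val (φ.map_src d)

theorem GraphIso.dst_subD (φ : GraphIso (G.induce A) (H.induce B))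
    (d : {d // G.src d ∈ A ∧ G.dst d ∈ A}) :
    H.dst (φ.subD d).1 = (φ.subV ⟨G.dst d.1, d.2.2⟩).1 := congrArg Subtype.val (φ.map_dst d)

theorem GraphIso.within_subV (φ : GraphIso (G.induce A) (H.induce B)) {n : ℕ} {x y : A}
    (hA : ∀ z, G.Within n x.1 z → z ∈ A) (h : G.Within n x.1 y.1) :
    H.Within n (φ.subV x).1 (φ.subV y).1 :=
  Within.of_induce (x := φ.subV x) (y := φ.subV y) (φ.within (h.induce hA))

theorem GraphIso.within_of_subV (φ : GraphIso (G.induce A) (H.induce B)) {n : ℕ} {x y : A}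
    (hB : ∀ z, H.Within n (φ.subV x).1 z → z ∈ B) (h : H.Within n (φ.subV x).1 (φ.subV y).1) :
    G.Within n x.1 y.1 :=
  (φ.within_iff.1 (h.induce hB)).of_induce

/-- Restriction of an isomorphism between induced subnetworks to smaller induced subnetworks. -/
def GraphIso.restrict (φ : GraphIso (G.induce A) (H.induce B)) (hA : A' ⊆ A) (hB : B' ⊆ B)
    (h : ∀ x : A, x.1 ∈ A' ↔ (φ.subV x).1 ∈ B') : GraphIso (G.induce A') (H.induce B') :=
  let v : A' ≃ B' :=
    { toFun := fun x => ⟨(φ.subV ⟨x.1, hA x.2⟩).1, (h _).1 x.2⟩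
      invFun := fun y => ⟨(φ.subV.symm ⟨y.1, hB y.2⟩).1, (h _).2 (by
        rw [Equiv.apply_symm_apply]; exact y.2)⟩
      left_inv := fun x => Subtype.ext (congrArg Subtype.val
        (φ.subV.symm_apply_apply ⟨x.1, hA x.2⟩) :)
      right_inv := fun y => Subtype.ext (congrArg Subtype.val
        (φ.subV.apply_symm_apply ⟨y.1, hB y.2⟩) :) }
  let e : {d // G.src d ∈ A' ∧ G.dst d ∈ A'} ≃ {d // H.src d ∈ B' ∧ H.dst d ∈ B'} :=
    { toFun := fun d => ⟨(φ.subD ⟨d.1, hA d.2.1, hA d.2.2⟩).1, by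
        rw [φ.src_subD, φ.dst_subD, ← h, ← h]
        exact d.2⟩
      invFun := fun d => ⟨(φ.subD.symm ⟨d.1, hB d.2.1, hB d.2.2⟩).1, by
        have h1 := φ.src_subD (φ.subD.symm ⟨d.1, hB d.2.1, hB d.2.2⟩)
        have h2 := φ.dst_subD (φ.subD.symm ⟨d.1, hB d.2.1, hB d.2.2⟩)
        rw [Equiv.apply_symm_apply] at h1 h2
        exact ⟨(h _).2 (h1 ▸ d.2.1), (h _).2 (h2 ▸ d.2.2)⟩⟩
      left_inv := fun d => Subtype.ext (congrArg Subtype.val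
        (φ.subD.symm_apply_apply ⟨d.1, hA d.2.1, hA d.2.2⟩) :)
      right_inv := fun d => Subtype.ext (congrArg Subtype.val
        (φ.subD.apply_symm_apply ⟨d.1, hB d.2.1, hB d.2.2⟩) :) }
  { onV := v
    onD := e
    map_src := fun d => Subtype.ext (φ.src_subD ⟨d.1, hA d.2.1, hA d.2.2⟩)
    map_rev := fun d => Subtype.ext
      (congrArg (fun d : {d // H.src d ∈ B ∧ H.dst d ∈ B} => d.1)
        (φ.map_rev ⟨d.1, hA d.2.1, hA d.2.2⟩)) }

end Induce

theorem GraphIso.MarksWithin.restrict [PseudoMetricSpace Ξ] {G H : Network Ξ} {A A' : Set G.V}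
    {B B' : Set H.V} {φ : GraphIso (G.induce A) (H.induce B)} {ε δ : ℝ} (hφ : φ.MarksWithin ε)
    (hε : ε ≤ δ) (hA : A' ⊆ A) (hB : B' ⊆ B) (h : ∀ x : A, x.1 ∈ A' ↔ (φ.subV x).1 ∈ B') :
    (φ.restrict hA hB h).MarksWithin δ := by
  refine ⟨fun x => ?_, fun d => ?_⟩
  · exact lt_of_lt_of_le (hφ.1 ⟨x.1, hA x.2⟩) hε
  · exact lt_of_lt_of_le (hφ.2 ⟨d.1, hA d.2.1, hA d.2.2⟩) hε

/-- Restriction of an isomorphism to induced subnetworks. -/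
def GraphIso.induce {G : Network Ξ} {H : Network Ξ'} (φ : GraphIso G H) {A : Set G.V}
    {B : Set H.V} (h : ∀ x, x ∈ A ↔ φ.onV x ∈ B) : GraphIso (G.induce A) (H.induce B) where
  onV := φ.onV.subtypeEquiv h
  onD := φ.onD.subtypeEquiv fun d => by rw [φ.map_src, φ.map_dst, ← h, ← h]
  map_src d := Subtype.ext (φ.map_src d.1)
  map_rev d := Subtype.ext (φ.map_rev d.1)

end Network

/-! ### Continuity in the local topology -/

namespace RootedNetwork

variable {Ξ : Type} {k : ℕ}

theorem mem_ball {G : RootedNetwork Ξ k} {r : ℝ} {x : G.net.V} :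
    x ∈ G.ball r ↔ ∃ i, G.net.Within ⌊r⌋₊ (G.root i) x :=
  exists_congr fun _ => Network.dist_le_iff_within G.connected

theorem mem_ball_iso {G H : RootedNetwork Ξ k} (φ : Network.GraphIso G.net H.net)
    (hr : ∀ i, φ.onV (G.root i) = H.root i) (r : ℝ) (x : G.net.V) :
    x ∈ G.ball r ↔ φ.onV x ∈ H.ball r := by
  rw [mem_ball, mem_ball]
  exact exists_congr fun i => by rw [← hr, φ.within_iff]

variable [PseudoMetricSpace Ξ]

/-- Paths of length at most `⌊s⌋` from points within `a` of a root stay in the `r`-balls on both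
sides, so the given isomorphism matches the smaller balls and restricts to them. The case `a = 0`
reindexes roots, the case `a = 1` adds a neighbour. -/
theorem Close.of_reroot {G H : RootedNetwork Ξ k} {r s : ℝ} (hs : 0 < s) (hsr : s ≤ r)
    {φ : Network.GraphIso (G.net.induce (G.ball r)) (H.net.induce (H.ball r))}
    (hφ : φ.MarksWithin (1 / r))
    (hroot : ∀ i, φ.subV ⟨G.root i, G.root_mem_ball r i⟩ = ⟨H.root i, H.root_mem_ball r i⟩)
    {a : ℕ} (ha : a + ⌊s⌋₊ ≤ ⌊r⌋₊) {l : ℕ} (v : Fin l → G.ball r)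
    (hv : ∀ j, ∃ i, G.net.Within a (G.root i) (v j)) :
    Close s (G.reroot fun j => (v j).1) (H.reroot fun j => (φ.subV (v j)).1) := by
  have hv' : ∀ j, ∃ i, H.net.Within a (H.root i) (φ.subV (v j)).1 := fun j => by
    obtain ⟨i, hi⟩ := hv j
    have h1 := φ.within_subV (x := ⟨G.root i, G.root_mem_ball r i⟩)
      (fun z hz => mem_ball.2 ⟨i, hz.mono (by omega)⟩) hi
    rw [hroot] at h1
    exact ⟨i, h1⟩
  have hA : ∀ j z, G.net.Within ⌊s⌋₊ (v j) z → z ∈ G.ball r := fun j z hz =>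
    let ⟨i, hi⟩ := hv j
    mem_ball.2 ⟨i, (hi.trans hz).mono ha⟩
  have hB : ∀ j z, H.net.Within ⌊s⌋₊ (φ.subV (v j)).1 z → z ∈ H.ball r := fun j z hz =>
    let ⟨i, hi⟩ := hv' j
    mem_ball.2 ⟨i, (hi.trans hz).mono ha⟩
  have hAs : (G.reroot fun j => (v j).1).ball s ⊆ G.ball r := fun z hz =>
    let ⟨j, hj⟩ := mem_ball.1 hz
    hA j z hj
  have hBs : (H.reroot fun j => (φ.subV (v j)).1).ball s ⊆ H.ball r := fun z hz =>
    let ⟨j, hj⟩ := mem_ball.1 hz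
    hB j z hj
  have h : ∀ x : G.ball r, x.1 ∈ (G.reroot fun j => (v j).1).ball s ↔
      (φ.subV x).1 ∈ (H.reroot fun j => (φ.subV (v j)).1).ball s := fun x => by
    refine (mem_ball (G := G.reroot fun j => (v j).1)).trans (Iff.trans ?_
      (mem_ball (G := H.reroot fun j => (φ.subV (v j)).1)).symm)
    exact exists_congr fun j => ⟨φ.within_subV (hA j), φ.within_of_subV (hB j)⟩
  refine ⟨φ.restrict hAs hBs h,
    hφ.restrict (one_div_le_one_div_of_le hs hsr) hAs hBs h, fun j => ?_⟩
  exact Subtype.ext rfl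

theorem close_iff {G H : RootedNetwork Ξ k} {r : ℝ} : Close r G H ↔
    ∃ φ : Network.GraphIso (G.net.induce (G.ball r)) (H.net.induce (H.ball r)),
      φ.MarksWithin (1 / r) ∧
        ∀ i, φ.subV ⟨G.root i, G.root_mem_ball r i⟩ = ⟨H.root i, H.root_mem_ball r i⟩ := Iff.rfl

theorem Close.mono {G H : RootedNetwork Ξ k} {r s : ℝ} (hs : 0 < s) (hsr : s ≤ r)
    (h : Close r G H) : Close s G H := by
  obtain ⟨φ, hφ, hroot⟩ := close_iff.1 h
  have h1 := Close.of_reroot hs hsr hφ hroot (a := 0) (by rw [zero_add]; exact Nat.floor_mono hsr)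
    (fun i => ⟨G.root i, G.root_mem_ball r i⟩) fun j => ⟨j, rfl⟩
  simp only [hroot] at h1
  exact h1

theorem Close.of_isomorphic {G G' H H' : RootedNetwork Ξ k} {r : ℝ} (hG : Isomorphic G' G)
    (h : Close r G H) (hH : Isomorphic H H') : Close r G' H' := by
  obtain ⟨α, ⟨hα, hα'⟩, hαr⟩ := hG
  obtain ⟨β, ⟨hβ, hβ'⟩, hβr⟩ := hH
  obtain ⟨φ, ⟨hφ, hφ'⟩, hr⟩ := h
  refine ⟨((α.induce (mem_ball_iso α hαr r)).trans φ).trans (β.induce (mem_ball_iso β hβr r)),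
    ⟨fun x => ?_, fun d => ?_⟩, fun i => ?_⟩
  · have h1 := hφ ((α.induce (mem_ball_iso α hαr r)).onV x)
    have h2 : H'.net.vmark (β.onV ((φ.subV ((α.induce (mem_ball_iso α hαr r)).subV x)).1)) =
      H.net.vmark (φ.subV ((α.induce (mem_ball_iso α hαr r)).subV x)).1 := hβ _
    have h3 : G.net.vmark (α.onV x.1) = G'.net.vmark x.1 := hα x.1
    exact lt_of_eq_of_lt (congrArg₂ dist h3.symm h2) h1
  · have h1 := hφ' ((α.induce (mem_ball_iso α hαr r)).onD d)
    have h2 : H'.net.emark (β.onD ((φ.subD ((α.induce (mem_ball_iso α hαr r)).subD d)).1)) =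
      H.net.emark (φ.subD ((α.induce (mem_ball_iso α hαr r)).subD d)).1 := hβ' _
    have h3 : G.net.emark (α.onD d.1) = G'.net.emark d.1 := hα' d.1
    exact lt_of_eq_of_lt (congrArg₂ dist h3.symm h2) h1
  · have h1 : (α.induce (mem_ball_iso α hαr r)).onV ⟨G'.root i, G'.root_mem_ball r i⟩ =
        ⟨G.root i, G.root_mem_ball r i⟩ := Subtype.ext (hαr i)
    have h2 : (β.induce (mem_ball_iso β hβr r)).onV ⟨H.root i, H.root_mem_ball r i⟩ =
        ⟨H'.root i, H'.root_mem_ball r i⟩ := Subtype.ext (hβr i)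
    show (β.induce (mem_ball_iso β hβr r)).onV
      (φ.onV ((α.induce (mem_ball_iso α hαr r)).onV _)) = _
    rw [h1, hr, h2]

theorem close_refl (G : RootedNetwork Ξ k) {r : ℝ} (hr : 0 < r) : Close r G G :=
  ⟨.refl _, ⟨fun x => by simpa [Network.GraphIso.refl] using hr,
    fun d => by simpa [Network.GraphIso.refl] using hr⟩, fun _ => rfl⟩

/-- The filter of networks that are close to `G`. -/
def closeFilter (G : RootedNetwork Ξ k) : Filter (RootedNetwork Ξ k) :=
  ⨅ R : ℕ, 𝓟 {H | Close (R + 1 : ℝ) G H}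

theorem Close.mono_nat {G H : RootedNetwork Ξ k} {R S : ℕ} (h : S ≤ R)
    (hGH : Close (R + 1 : ℝ) G H) : Close (S + 1 : ℝ) G H :=
  hGH.mono (by positivity) (by gcongr)

theorem closeFilter_hasBasis (G : RootedNetwork Ξ k) :
    (closeFilter G).HasBasis (fun _ : ℕ => True) fun R => {H | Close (R + 1 : ℝ) G H} :=
  hasBasis_iInf_principal (directed_of_isDirected_le fun _ _ h _ hH => Close.mono_nat h hH)

theorem eventually_close (G : RootedNetwork Ξ k) (R : ℕ) :
    ∀ᶠ H in closeFilter G, Close (R + 1 : ℝ) G H :=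
  (closeFilter_hasBasis G).mem_of_mem trivial

/-- A finite function of rooted networks that is continuous for the local topology. -/
structure LocalFn (F : RootedNetwork Ξ k → ℝ≥0∞) : Prop where
  ne_top : ∀ G, F G ≠ ∞
  tendsto : ∀ G, Tendsto F (closeFilter G) (𝓝 (F G))

namespace LocalFn

/-- An isomorphic network lies in every basic neighbourhood of `G`, so continuity already forces
invariance. -/
theorem congr_isomorphic {F : RootedNetwork Ξ k → ℝ≥0∞} (hF : LocalFn F) {G H : RootedNetwork Ξ k}
    (h : Isomorphic G H) : F G = F H := by
  have h1 : pure H ≤ closeFilter G := by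
    refine le_iInf fun R => ?_
    rw [le_principal_iff, mem_pure]
    exact Close.of_isomorphic ((setoid Ξ k).refl G) (close_refl G (by positivity)) h
  exact tendsto_nhds_unique ((hF.tendsto G).mono_left h1) (tendsto_pure_nhds F H)

/-- By invariance the chosen representative is irrelevant, and closeness of balls is what the local
distance measures; the function is therefore continuous on classes. -/
theorem measurable {F : RootedNetwork Ξ k → ℝ≥0∞} (hF : LocalFn F) :
    Measurable fun p : NetworkSpace Ξ k => F (Quotient.out p) := by
  refine Continuous.measurable ⟨fun U hU p hp => ?_⟩
  obtain ⟨R, -, hR⟩ := (closeFilter_hasBasis (Quotient.out p)).mem_iff.1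
    (hF.tendsto _ (hU.mem_nhds hp))
  -- A distance below this bound forces the supremum above `R + 1`, hence close balls at some `r > R
  -- + 1`.
  refine ⟨(1 + (R + 1 : ℕ))⁻¹, ENNReal.inv_pos.2 (by finiteness), fun q hq => ?_⟩
  rw [NetworkSpace.localDist, ENNReal.inv_lt_inv] at hq
  obtain ⟨⟨r, hr, G, H, hG, hH, hGH⟩, hlt⟩ := lt_iSup_iff.1 (lt_of_add_lt_add_left hq)
  have hG' : Isomorphic (Quotient.out p) G :=
    Quotient.exact (s := setoid Ξ k) ((Quotient.out_eq p).trans hG.symm)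
  have hH' : Isomorphic H (Quotient.out q) :=
    Quotient.exact (s := setoid Ξ k) (hH.trans (Quotient.out_eq q).symm)
  refine hR (a := Quotient.out q) (Close.of_isomorphic hG' (hGH.mono (by positivity) ?_) hH')
  rw [← ENNReal.ofReal_natCast, ENNReal.ofReal_lt_ofReal_iff hr] at hlt
  exact_mod_cast hlt.le

theorem const {c : ℝ≥0∞} (hc : c ≠ ∞) : LocalFn fun _ : RootedNetwork Ξ k => c :=
  ⟨fun _ => hc, fun _ => tendsto_const_nhds⟩

variable {F F' : RootedNetwork Ξ k → ℝ≥0∞}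

theorem add (hF : LocalFn F) (hF' : LocalFn F') : LocalFn fun G => F G + F' G :=
  ⟨fun G => ENNReal.add_ne_top.2 ⟨hF.ne_top G, hF'.ne_top G⟩,
    fun G => (hF.tendsto G).add (hF'.tendsto G)⟩

theorem mul (hF : LocalFn F) (hF' : LocalFn F') : LocalFn fun G => F G * F' G :=
  ⟨fun G => ENNReal.mul_ne_top (hF.ne_top G) (hF'.ne_top G),
    fun G => ENNReal.Tendsto.mul (hF.tendsto G) (.inr (hF'.ne_top G)) (hF'.tendsto G)
      (.inr (hF.ne_top G))⟩

theorem sub (hF : LocalFn F) (hF' : LocalFn F') : LocalFn fun G => F G - F' G :=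
  ⟨fun G => ne_top_of_le_ne_top (hF.ne_top G) tsub_le_self,
    fun G => ENNReal.Tendsto.sub (hF.tendsto G) (hF'.tendsto G) (.inl (hF.ne_top G))⟩

theorem min (hF : LocalFn F) (hF' : LocalFn F') : LocalFn fun G => Min.min (F G) (F' G) :=
  ⟨fun G => ne_top_of_le_ne_top (hF.ne_top G) (min_le_left _ _),
    fun G => (hF.tendsto G).min (hF'.tendsto G)⟩

theorem reindex (hF : LocalFn F) {l : ℕ} (σ : Fin k → Fin l) :
    LocalFn fun G : RootedNetwork Ξ l => F (G.reroot (G.root ∘ σ)) := by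
  refine ⟨fun G => hF.ne_top _, fun G => (hF.tendsto _).comp ?_⟩
  rw [((closeFilter_hasBasis G).tendsto_iff (closeFilter_hasBasis _))]
  refine fun R _ => ⟨R, trivial, ?_⟩
  intro H hH
  obtain ⟨φ, hφ, hroot⟩ := close_iff.1 hH
  have h1 := Close.of_reroot (s := (R + 1 : ℝ)) (by positivity) le_rfl hφ hroot (a := 0)
    (by rw [zero_add]) (fun j => ⟨G.root (σ j), G.root_mem_ball _ _⟩) fun j => ⟨σ j, rfl⟩
  simp only [hroot] at h1
  exact h1

theorem kone (i j : Fin k) :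
    LocalFn fun G : RootedNetwork Ξ k => UnimodularNetwork.kone (G.root i) (G.root j) := by
  refine ⟨fun G => by unfold UnimodularNetwork.kone; split_ifs <;> simp, fun G => ?_⟩
  refine tendsto_nhds_of_eventually_eq ?_
  filter_upwards [eventually_close G 0] with H hH
  obtain ⟨φ, -, hroot⟩ := close_iff.1 hH
  have h1 : H.root i = H.root j ↔ G.root i = G.root j := by
    constructor
    · intro h
      have h2 : φ.subV ⟨G.root i, G.root_mem_ball _ i⟩ =
          φ.subV ⟨G.root j, G.root_mem_ball _ j⟩ := by
        rw [hroot, hroot]; exact Subtype.ext h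
      exact congrArg Subtype.val (φ.subV.injective h2)
    · intro h
      have h2 := hroot j
      simp only [← h, hroot] at h2
      exact congrArg Subtype.val h2
  unfold UnimodularNetwork.kone
  by_cases h : G.root i = G.root j
  · rw [if_pos h, if_pos (h1.2 h)]
  · rw [if_neg h, if_neg (h1.not.2 h)]

end LocalFn

theorem eventually_exists_edge_equiv (G : RootedNetwork Ξ k) (i : Fin k) (R : ℕ) :
    ∀ᶠ H in closeFilter G,
      ∃ β : {d // G.net.src d = G.root i} ≃ {d // H.net.src d = H.root i}, ∀ d,
        Close (R + 1 : ℝ) (G.reroot (Fin.cons (G.net.dst d.1) G.root))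
          (H.reroot (Fin.cons (H.net.dst (β d).1) H.root)) ∧
        dist (G.net.emark d.1) (H.net.emark (β d).1) < 1 / (R + 1) := by
  -- One extra unit of radius pays for rerooting at the far endpoint of an edge.
  filter_upwards [eventually_close G (R + 1)] with H hH
  obtain ⟨r, hr⟩ : ∃ r : ℝ, r = ((R + 1 : ℕ) : ℝ) + 1 := ⟨_, rfl⟩
  rw [← hr] at hH
  obtain ⟨φ, hφ, hroot⟩ := close_iff.1 hH
  have hfl : ⌊r⌋₊ = R + 2 := by
    rw [hr, show ((R + 1 : ℕ) : ℝ) + 1 = ((R + 2 : ℕ) : ℝ) by push_cast; ring, Nat.floor_natCast]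
  have hmem : ∀ (K : RootedNetwork Ξ k) (d : K.net.D), K.net.src d = K.root i →
      K.net.src d ∈ K.ball r ∧ K.net.dst d ∈ K.ball r := fun K d hd => by
    refine ⟨hd ▸ K.root_mem_ball r i, mem_ball.2 ⟨i, ?_⟩⟩
    rw [← hd]
    exact (K.net.within_one d).mono (by omega)
  have hsrc : ∀ d : {d // G.net.src d ∈ G.ball r ∧ G.net.dst d ∈ G.ball r},
      G.net.src d.1 = G.root i ↔ H.net.src (φ.subD d).1 = H.root i := fun d => by
    have h2 : H.root i = (φ.subV ⟨G.root i, G.root_mem_ball r i⟩).1 := by rw [hroot]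
    rw [φ.src_subD, h2, ← Subtype.ext_iff, φ.subV.apply_eq_iff_eq, Subtype.mk.injEq]
  let β : {d // G.net.src d = G.root i} ≃ {d // H.net.src d = H.root i} :=
    { toFun := fun d => ⟨(φ.subD ⟨d.1, hmem G d.1 d.2⟩).1, (hsrc _).1 d.2⟩
      invFun := fun d => ⟨(φ.subD.symm ⟨d.1, hmem H d.1 d.2⟩).1, (hsrc _).2 (by
        rw [Equiv.apply_symm_apply]; exact d.2)⟩
      left_inv := fun d => Subtype.ext (congrArg Subtype.val
        (φ.subD.symm_apply_apply ⟨d.1, hmem G d.1 d.2⟩) :)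
      right_inv := fun d => Subtype.ext (congrArg Subtype.val
        (φ.subD.apply_symm_apply ⟨d.1, hmem H d.1 d.2⟩) :) }
  have hR : (R + 1 : ℝ) ≤ r := by rw [hr]; push_cast; linarith
  refine ⟨β, fun d => ⟨?_, ?_⟩⟩
  · have hd := hmem G d.1 d.2
    have h1 := Close.of_reroot (s := (R + 1 : ℝ)) (by positivity) hR hφ hroot (a := 1)
      (by rw [hfl, show (R + 1 : ℝ) = ((R + 1 : ℕ) : ℝ) by push_cast; ring, Nat.floor_natCast]
          omega)
      (Fin.cons (⟨G.net.dst d.1, hd.2⟩ : G.ball r)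
        (fun i => ⟨G.root i, G.root_mem_ball r i⟩ : Fin k → G.ball r)) (fun j => by
        refine Fin.cases ?_ (fun j => ?_) j
        · refine ⟨i, ?_⟩
          have h2 := G.net.within_one d.1
          rw [d.2] at h2
          exact h2
        · exact ⟨j, G.net.within_refl 1 _⟩)
    have hdst : H.net.dst (β d).1 = (φ.subV ⟨G.net.dst d.1, hd.2⟩).1 :=
      φ.dst_subD ⟨d.1, hd⟩
    convert h1 using 2
    · funext j
      refine Fin.cases ?_ (fun j => ?_) j <;> simp
    · funext j
      refine Fin.cases ?_ (fun j => ?_) j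
      · simp [hdst]
      · simp [hroot]
  · exact lt_of_lt_of_le (hφ.2 ⟨d.1, hmem G d.1 d.2⟩)
      (one_div_le_one_div_of_le (by positivity) hR)

/-- Nearby networks have matched edges at the root, with close marks and close rerooted networks. As
the edges are finitely many, one radius serves all of them. -/
theorem LocalFn.edgeSum {F : RootedNetwork Ξ (k + 1) → ℝ≥0∞} (hF : LocalFn F) {ψ : Ξ → ℝ≥0}
    (hψ : Continuous ψ) (i : Fin k) : LocalFn fun G : RootedNetwork Ξ k =>
      ∑' d : {d // G.net.src d = G.root i},
        (ψ (G.net.emark d.1) : ℝ≥0∞) * F (G.reroot (Fin.cons (G.net.dst d.1) G.root)) := by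
  have hfin : ∀ G : RootedNetwork Ξ k, Finite {d // G.net.src d = G.root i} :=
    fun G => G.locallyFinite (G.root i)
  refine ⟨fun G => ?_, fun G => ?_⟩
  · have := hfin G
    have := Fintype.ofFinite {d // G.net.src d = G.root i}
    rw [tsum_fintype]
    exact ENNReal.sum_ne_top.2 fun d _ => ENNReal.mul_ne_top ENNReal.coe_ne_top (hF.ne_top _)
  · have := hfin G
    have := Fintype.ofFinite {d // G.net.src d = G.root i}
    set g : {d // G.net.src d = G.root i} → RootedNetwork Ξ (k + 1) :=
      fun d => G.reroot (Fin.cons (G.net.dst d.1) G.root)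
    set T : {d // G.net.src d = G.root i} → ℝ≥0∞ :=
      fun d => (ψ (G.net.emark d.1) : ℝ≥0∞) * F (g d)
    rw [show (∑' d : {d // G.net.src d = G.root i},
        (ψ (G.net.emark d.1) : ℝ≥0∞) * F (G.reroot (Fin.cons (G.net.dst d.1) G.root))) =
          ∑ d, T d from tsum_fintype _]
    intro U hU
    have hsum : Tendsto (fun y : {d // G.net.src d = G.root i} → ℝ≥0∞ => ∑ d, y d) (𝓝 T)
        (𝓝 (∑ d, T d)) :=
      (continuous_finsetSum _ fun d _ => continuous_apply d).tendsto T
    have hU' := hsum hU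
    rw [Filter.mem_map, nhds_pi, Filter.mem_pi'] at hU'
    obtain ⟨I, s, hs, hsU⟩ := hU'
    have hstep : ∀ d, ∃ R : ℕ, ∀ m H, dist (G.net.emark d.1) m < 1 / (R + 1 : ℝ) →
        Close (R + 1 : ℝ) (g d) H → (ψ m : ℝ≥0∞) * F H ∈ s d := by
      intro d
      have h1 : Tendsto (fun p : Ξ × RootedNetwork Ξ (k + 1) => (ψ p.1 : ℝ≥0∞) * F p.2)
          (𝓝 (G.net.emark d.1) ×ˢ closeFilter (g d)) (𝓝 (T d)) := by
        refine ENNReal.Tendsto.mul ?_ (.inr (hF.ne_top _)) ((hF.tendsto _).comp tendsto_snd)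
          (.inr ENNReal.coe_ne_top)
        exact (ENNReal.continuous_coe.comp hψ).continuousAt.tendsto.comp tendsto_fst
      obtain ⟨pa, ha, pb, hb, hab⟩ := eventually_prod_iff.1 (h1 (hs d))
      obtain ⟨ε, hε, hball⟩ := Metric.eventually_nhds_iff.1 ha
      obtain ⟨R, -, hR⟩ := (closeFilter_hasBasis (g d)).mem_iff.1 hb
      obtain ⟨N, hN⟩ := exists_nat_one_div_lt hε
      refine ⟨max N R, fun m H hm hH => hab (hball ?_) (hR (hH.mono_nat (le_max_right _ _)))⟩
      rw [dist_comm]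
      refine hm.trans_le (le_trans ?_ hN.le)
      exact one_div_le_one_div_of_le (by positivity) (by gcongr; exact le_max_left _ _)
    choose R hR using hstep
    rw [Filter.mem_map]
    filter_upwards [eventually_exists_edge_equiv G i (Finset.univ.sup R)] with H hH
    obtain ⟨β, hβ⟩ := hH
    rw [mem_preimage, ← β.tsum_eq, tsum_fintype]
    refine hsU (a := fun d => (ψ (H.net.emark (β d).1) : ℝ≥0∞) *
      F (H.reroot (Fin.cons (H.net.dst (β d).1) H.root))) fun d _ => ?_
    have hle : R d ≤ Finset.univ.sup R := Finset.le_sup (Finset.mem_univ d)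
    refine hR d _ _ ((hβ d).2.trans_le ?_) ((hβ d).1.mono_nat hle)
    exact one_div_le_one_div_of_le (by positivity) (by gcongr)

end RootedNetwork

/-! ### Positive forms and Cauchy–Schwarz in `[0,∞]` -/

section PositiveForm

variable {V : Type}

theorem kmul_swap {X Y X' Y' : V → V → ℝ≥0∞} (hX : ∀ x y, X x y = X' y x)
    (hY : ∀ x y, Y x y = Y' y x) (x y : V) : kmul X Y x y = kmul Y' X' y x := by
  simp only [kmul, hX, hY]
  exact tsum_congr fun z => mul_comm _ _

theorem kone_symm (x y : V) : (kone x y : ℝ≥0∞) = kone y x := by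
  by_cases h : x = y <;> simp [kone, h, eq_comm]

theorem kpow_symm {X : V → V → ℝ≥0∞} (hX : ∀ x y, X x y = X y x) (n : ℕ) (x y : V) :
    kpow X n x y = kpow X n y x := by
  induction n generalizing x y with
  | zero => exact kone_symm x y
  | succ n ih =>
    calc kpow X (n + 1) x y = kmul (kpow X n) X y x := kmul_swap hX ih x y
      _ = kpow X (n + 1) y x := by rw [kpow_add, kpow_one]

/-- The bilinear form of a kernel. -/
def kform (S : V → V → ℝ≥0∞) (u v : V → ℝ≥0∞) : ℝ≥0∞ := ∑' y, (∑' x, u x * S x y) * v y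

/-- The Cauchy–Schwarz inequality for the form of `S` on nonnegative functions, in additive form. -/
def PosForm (S : V → V → ℝ≥0∞) : Prop :=
  ∀ u v, 2 * kform S u v ≤ kform S u u + kform S v v

theorem kmul_kmul_apply (X S Y : V → V → ℝ≥0∞) (x y : V) :
    kmul (kmul X S) Y x y = kform S (X x) fun z => Y z y := rfl

theorem two_mul_mul_le (a b : ℝ≥0∞) : 2 * (a * b) ≤ a * a + b * b := by
  wlog h : a ≤ b generalizing a b
  · rw [mul_comm a b, add_comm]
    exact this b a (le_of_not_ge h)
  · obtain ⟨c, rfl⟩ := exists_add_of_le h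
    calc 2 * (a * (a + c)) ≤ 2 * (a * (a + c)) + c * c := le_self_add
      _ = a * a + (a + c) * (a + c) := by ring

theorem posForm_kone : PosForm (kone : V → V → ℝ≥0∞) := by
  have h : ∀ u v : V → ℝ≥0∞, kform kone u v = ∑' y, u y * v y := fun u v => by
    refine tsum_congr fun y => ?_
    rw [tsum_eq_single y fun z hz => by simp [kone, hz]]
    simp [kone]
  intro u v
  simp only [h]
  rw [← ENNReal.tsum_mul_left, ← ENNReal.tsum_add]
  exact ENNReal.tsum_le_tsum fun y => two_mul_mul_le _ _

/-- Symmetric diagonally dominant kernels have a positive form. -/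
theorem posForm_addDiag {q : V → V → ℝ≥0∞} {h : V → ℝ≥0} (hq : ∀ x y, q x y = q y x)
    (hd : ∀ x, ∑' y, q x y ≤ h x) : PosForm (addDiag h q) := by
  set r : V → ℝ≥0∞ := fun x => h x - ∑' y, q x y with hr
  -- Splitting the row sum of `q` off `h` leaves the signless Laplacian, whose form is a sum of
  -- products of `u x + u y` and `v x + v y`. The factor 2 accounts for the two orders of each pair.
  have key : ∀ u v : V → ℝ≥0∞, 2 * kform (addDiag h q) u v = 2 * ∑' x, r x * (u x * v x) +
      ∑' x, ∑' y, q x y * ((u x + u y) * (v x + v y)) := by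
    intro u v
    have e1 : kform (addDiag h q) u v = ∑' x, h x * (u x * v x) +
        ∑' x, ∑' y, q x y * (u x * v y) := by
      have h1 : ∀ y, (∑' x, u x * addDiag h q x y) * v y =
          h y * (u y * v y) + ∑' x, q x y * (u x * v y) := fun y => by
        simp only [addDiag, mul_add]
        rw [ENNReal.tsum_add, tsum_eq_single y (f := fun x => u x * (h x * kone x y))
          fun z hz => by simp [kone, hz], add_mul, ← ENNReal.tsum_mul_right, add_comm]
        congr 1
        · simp only [kone, if_true]; ring
        · exact tsum_congr fun x => by ring
      rw [kform, tsum_congr h1, ENNReal.tsum_add, ENNReal.tsum_comm]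
    have e2 : ∑' x, h x * (u x * v x) = ∑' x, r x * (u x * v x) +
        ∑' x, ∑' y, q x y * (u x * v x) := by
      rw [← ENNReal.tsum_add]
      refine tsum_congr fun x => ?_
      rw [ENNReal.tsum_mul_right, ← add_mul, hr]
      simp only
      rw [tsub_add_cancel_of_le (hd x)]
    have e3 : ∑' x, ∑' y, q x y * (u x * v x) = ∑' x, ∑' y, q x y * (u y * v y) := by
      rw [ENNReal.tsum_comm]
      exact tsum_congr fun x => tsum_congr fun y => by rw [hq]
    have e4 : ∑' x, ∑' y, q x y * (u x * v y) = ∑' x, ∑' y, q x y * (u y * v x) := by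
      rw [ENNReal.tsum_comm]
      exact tsum_congr fun x => tsum_congr fun y => by rw [hq]
    have e5 : ∑' x, ∑' y, q x y * ((u x + u y) * (v x + v y)) =
        ∑' x, ∑' y, q x y * (u x * v x) + ∑' x, ∑' y, q x y * (u y * v y) +
          (∑' x, ∑' y, q x y * (u x * v y) + ∑' x, ∑' y, q x y * (u y * v x)) := by
      simp only [← ENNReal.tsum_add]
      exact tsum_congr fun x => tsum_congr fun y => by ring
    rw [e5, ← e3, ← e4, e1, e2]
    ring
  intro u v
  have h2 : 2 * (2 * kform (addDiag h q) u v) ≤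
      2 * (kform (addDiag h q) u u + kform (addDiag h q) v v) := by
    rw [mul_add 2 (kform (addDiag h q) u u), key u v, key u u, key v v, mul_add]
    have i1 : 2 * (2 * ∑' x, r x * (u x * v x)) ≤
        2 * ∑' x, r x * (u x * u x) + 2 * ∑' x, r x * (v x * v x) := by
      rw [← mul_add, ← ENNReal.tsum_add, ← ENNReal.tsum_mul_left]
      refine mul_le_mul_right (ENNReal.tsum_le_tsum fun x => ?_) _
      rw [← mul_add, mul_left_comm]
      exact mul_le_mul_right (two_mul_mul_le _ _) _
    have i2 : 2 * ∑' x, ∑' y, q x y * ((u x + u y) * (v x + v y)) ≤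
        ∑' x, ∑' y, q x y * ((u x + u y) * (u x + u y)) +
          ∑' x, ∑' y, q x y * ((v x + v y) * (v x + v y)) := by
      simp only [← ENNReal.tsum_add, ← ENNReal.tsum_mul_left]
      refine ENNReal.tsum_le_tsum fun x => ENNReal.tsum_le_tsum fun y => ?_
      rw [← mul_add, mul_left_comm]
      exact mul_le_mul_right (two_mul_mul_le _ _) _
    refine (add_le_add i1 i2).trans_eq ?_
    ring
  exact (ENNReal.mul_le_mul_iff_right two_ne_zero ENNReal.ofNat_ne_top).1 h2

theorem PosForm.kpow_zero_or_one {X : V → V → ℝ≥0∞} (hX : PosForm X) {i : ℕ} (hi : i < 2) :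
    PosForm (kpow X i) := by
  interval_cases i
  · exact posForm_kone
  · rwa [kpow_one]

/-- Write `X^n` as `X^(n/2) X^(n%2) X^(n/2)` and apply the form inequality of the middle factor to
two rows of the half power. -/
theorem PosForm.two_mul_kpow_le {X : V → V → ℝ≥0∞} (hX : PosForm X)
    (hs : ∀ x y, X x y = X y x) (n : ℕ) (x y : V) :
    2 * kpow X n x y ≤ kpow X n x x + kpow X n y y := by
  have hn : n = n / 2 + n % 2 + n / 2 := by omega
  have h : ∀ x y, kpow X n x y =
      kform (kpow X (n % 2)) (kpow X (n / 2) x) (kpow X (n / 2) y) := fun x y => by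
    conv_lhs => rw [hn]
    rw [kpow_add, kpow_add, kmul_kmul_apply]
    congr 1
    funext z
    exact kpow_symm hs _ _ _
  simp only [h]
  exact hX.kpow_zero_or_one (Nat.mod_lt _ two_pos) _ _

end PositiveForm

/-! ### The two parts of the truncated walk kernel -/

namespace Network

variable {Ξ : Type}

/-- The jump rates thinned by the cutoff at both ends. -/
def thinnedRate (ψ η : Ξ → ℝ≥0) (K : ℕ) (G : Network Ξ) (x y : G.V) : ℝ≥0∞ :=
  G.cutoff η K x * G.weightRate ψ x y * G.cutoff η K y

/-- The diagonal part of `walkKernel`. -/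
def holdRate (ψ : Ξ → ℝ≥0) (K : ℕ) (G : Network Ξ) (x : G.V) : ℝ≥0 :=
  cutoffRate K - (∑' z, G.weightRate ψ x z).toNNReal

theorem walkKernel_eq (ψ η : Ξ → ℝ≥0) (K : ℕ) (G : Network Ξ) :
    G.walkKernel ψ η K = addDiag (holdRate ψ K G) (thinnedRate ψ η K G) := rfl

theorem coe_holdRate (ψ : Ξ → ℝ≥0) (K : ℕ) {G : Network Ξ} (hG : G.LocallyFinite) (x : G.V) :
    (holdRate ψ K G x : ℝ≥0∞) = cutoffRate K - ∑' z, G.weightRate ψ x z := by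
  rw [holdRate, ENNReal.coe_sub, ENNReal.coe_toNNReal (tsum_weightRate_ne_top ψ hG x)]

end Network

/-! ### Continuity of the walk kernels and their powers -/

section LocalKernel

variable {Ξ : Type} [PseudoMetricSpace Ξ]

open RootedNetwork Network

/-- A kernel, defined on all networks, that is continuous for the local topology. -/
def IsLocalKernel (X : ∀ G : Network Ξ, G.V → G.V → ℝ≥0∞) : Prop :=
  LocalFn fun G : RootedNetwork Ξ 2 => X G.net (G.root 0) (G.root 1)

theorem IsLocalKernel.at {X : ∀ G : Network Ξ, G.V → G.V → ℝ≥0∞} (hX : IsLocalKernel X) {k : ℕ}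
    (i j : Fin k) : LocalFn fun G : RootedNetwork Ξ k => X G.net (G.root i) (G.root j) :=
  LocalFn.reindex hX ![i, j]

theorem isLocalKernel_kone : IsLocalKernel fun G : Network Ξ => (kone : G.V → G.V → ℝ≥0∞) :=
  LocalFn.kone 0 1

variable {ψ η : Ξ → ℝ≥0}

theorem RootedNetwork.LocalFn.congr {k : ℕ}
    {F F' : RootedNetwork Ξ k → ℝ≥0∞} (hF : LocalFn F) (h : ∀ G, F' G = F G) : LocalFn F' :=
  (funext h : F' = F) ▸ hF

theorem localFn_tsum_weightRate_mul (hψ : Continuous ψ) {k : ℕ} (i : Fin k)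
    {F : RootedNetwork Ξ (k + 1) → ℝ≥0∞} (hF : LocalFn F) :
    LocalFn fun G : RootedNetwork Ξ k =>
      ∑' z, G.net.weightRate ψ (G.root i) z * F (G.reroot (Fin.cons z G.root)) := by
  -- The new root has index `0` and the old root `i` index `i.succ`, so the factor `1 - kone`
  -- removes loops.
  have h := (((LocalFn.const ENNReal.one_ne_top).sub (LocalFn.kone i.succ 0)).mul hF).edgeSum hψ i
  refine h.congr fun G => ?_
  rw [tsum_weightRate_mul]
  refine tsum_congr fun d => ?_
  congr 1
  show _ = (1 - kone (G.root i) (G.net.dst d.1)) * _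
  by_cases hd : G.root i = G.net.dst d.1 <;> simp [kone, hd]

theorem localFn_tsum_weightRate (hψ : Continuous ψ) {k : ℕ} (i : Fin k) :
    LocalFn fun G : RootedNetwork Ξ k => ∑' z, G.net.weightRate ψ (G.root i) z := by
  simpa only [mul_one] using localFn_tsum_weightRate_mul hψ i (LocalFn.const ENNReal.one_ne_top)

theorem localFn_cutoff (hη : Continuous η) (K : ℕ) {k : ℕ} (i : Fin k) :
    LocalFn fun G : RootedNetwork Ξ k => G.net.cutoff η K (G.root i) :=
  (LocalFn.const ENNReal.one_ne_top).min
    ((LocalFn.const (ENNReal.natCast_ne_top _)).sub (localFn_tsum_weightRate hη i))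

theorem localFn_holdRate (hψ : Continuous ψ) (K : ℕ) {k : ℕ} (i : Fin k) :
    LocalFn fun G : RootedNetwork Ξ k => (holdRate ψ K G.net (G.root i) : ℝ≥0∞) := by
  simp only [fun G : RootedNetwork Ξ k => coe_holdRate ψ K G.locallyFinite (G.root i)]
  exact (LocalFn.const ENNReal.coe_ne_top).sub (localFn_tsum_weightRate hψ i)

theorem localFn_tsum_thinnedRate_mul (hψ : Continuous ψ) (hη : Continuous η) (K : ℕ) {k : ℕ}
    (i : Fin k) {F : RootedNetwork Ξ (k + 1) → ℝ≥0∞} (hF : LocalFn F) :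
    LocalFn fun G : RootedNetwork Ξ k =>
      ∑' z, thinnedRate ψ η K G.net (G.root i) z * F (G.reroot (Fin.cons z G.root)) := by
  have h := (localFn_cutoff hη K i).mul
    (localFn_tsum_weightRate_mul hψ i ((localFn_cutoff hη K 0).mul hF))
  refine h.congr fun G => ?_
  rw [← ENNReal.tsum_mul_left]
  refine tsum_congr fun z => ?_
  simp only [thinnedRate, mul_assoc]
  rfl

/-- Multiplying by the identity kernel turns an entry into a neighbour sum; after the neighbour is
prepended, the target vertex has index `2`. -/
theorem isLocalKernel_thinnedRate (hψ : Continuous ψ) (hη : Continuous η) (K : ℕ) :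
    IsLocalKernel (thinnedRate ψ η K) := by
  have h := localFn_tsum_thinnedRate_mul hψ hη K (0 : Fin 2)
    ((isLocalKernel_kone (Ξ := Ξ)).at (k := 3) 0 2)
  refine h.congr fun G => ?_
  exact (congrFun (congrFun (kmul_kone (thinnedRate ψ η K G.net)) _) _).symm

theorem IsLocalKernel.walkKernel_kmul {X : ∀ G : Network Ξ, G.V → G.V → ℝ≥0∞}
    (hX : IsLocalKernel X) (hψ : Continuous ψ) (hη : Continuous η) (K : ℕ) :
    IsLocalKernel fun G => kmul (G.walkKernel ψ η K) (X G) := by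
  have h := (localFn_tsum_thinnedRate_mul hψ hη K (0 : Fin 2) (hX.at (k := 3) 0 2)).add
    ((localFn_holdRate hψ K (0 : Fin 2)).mul hX)
  refine h.congr fun G => ?_
  exact kmul_addDiag _ _ _ _ _

theorem IsLocalKernel.kpow_walkKernel_kmul {X : ∀ G : Network Ξ, G.V → G.V → ℝ≥0∞}
    (hX : IsLocalKernel X) (hψ : Continuous ψ) (hη : Continuous η) (K n : ℕ) :
    IsLocalKernel fun G => kmul (kpow (G.walkKernel ψ η K) n) (X G) := by
  induction n with
  | zero => simpa only [kpow, kone_kmul] using hX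
  | succ n ih =>
    simp only [kpow, kmul_assoc]
    exact ih.walkKernel_kmul hψ hη K

theorem isLocalKernel_kpow_walkKernel (hψ : Continuous ψ) (hη : Continuous η) (K n : ℕ) :
    IsLocalKernel fun G => kpow (G.walkKernel ψ η K) n := by
  simpa only [kmul_kone] using isLocalKernel_kone.kpow_walkKernel_kmul hψ hη K n

end LocalKernel

/-! ### The trace of a unimodular measure -/

section Trace

variable {Ξ : Type} [PseudoMetricSpace Ξ]

open RootedNetwork Network

/-- The root of the chosen representative of a rooted network. -/
def outRoot (p : NetworkSpace Ξ 1) : (Quotient.out p).net.V := (Quotient.out p).root 0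

/-- The expected diagonal entry at the root of a kernel. -/
def trace (ν : Measure (NetworkSpace Ξ 1)) (X : ∀ G : Network Ξ, G.V → G.V → ℝ≥0∞) : ℝ≥0∞ :=
  ∫⁻ p, X (Quotient.out p).net (outRoot p) (outRoot p) ∂ν

variable {ν : Measure (NetworkSpace Ξ 1)} {X Y : ∀ G : Network Ξ, G.V → G.V → ℝ≥0∞}

/-- The Mass-Transport Principle for the mass `X(x,y)`; invariance under isomorphism lets chosen
representatives be used. -/
theorem lintegral_tsum_swap (hν : IsUnimodular ν) (hX : IsLocalKernel X) :
    ∫⁻ p, ∑' z, X (Quotient.out p).net (outRoot p) z ∂ν =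
      ∫⁻ p, ∑' z, X (Quotient.out p).net z (outRoot p) ∂ν := by
  have hmk : ∀ G : RootedNetwork Ξ 2,
      X (Quotient.out (NetworkSpace.mk G)).net ((Quotient.out (NetworkSpace.mk G)).root 0)
        ((Quotient.out (NetworkSpace.mk G)).root 1) = X G.net (G.root 0) (G.root 1) := fun G =>
    LocalFn.congr_isomorphic hX (Quotient.exact (s := setoid Ξ 2) (Quotient.out_eq _))
  have h := hν.2 _ (LocalFn.measurable hX)
  convert h using 2
  · funext p
    conv_rhs => rw [← Quotient.out_eq p]
    exact tsum_congr fun z => (hmk ((Quotient.out p).reroot ![outRoot p, z])).symm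
  · funext p
    conv_rhs => rw [← Quotient.out_eq p]
    exact tsum_congr fun z => (hmk ((Quotient.out p).reroot ![z, outRoot p])).symm

/-- The Mass-Transport Principle for the mass `X(x,y) Y(y,x)`. -/
theorem trace_kmul_comm (hν : IsUnimodular ν) (hX : IsLocalKernel X) (hY : IsLocalKernel Y) :
    trace ν (fun G => kmul (X G) (Y G)) = trace ν (fun G => kmul (Y G) (X G)) := by
  have h := lintegral_tsum_swap hν (X := fun G x y => X G x y * Y G y x)
    ((hX.at 0 1).mul (hY.at 1 0))
  refine h.trans (lintegral_congr fun p => ?_)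
  exact tsum_congr fun z => mul_comm _ _

theorem trace_le (hν : IsProbabilityMeasure ν) {c : ℝ≥0∞}
    (hX : ∀ (G : Network Ξ) x, ∑' y, X G x y ≤ c) : trace ν X ≤ c := by
  calc trace ν X ≤ ∫⁻ _, c ∂ν := lintegral_mono fun p => (ENNReal.le_tsum _).trans (hX _ _)
    _ = c := by simp

end Trace

/-! ### Symmetry, positivity and comparison of walk kernels -/

namespace Network

variable {Ξ : Type} {ψ η : Ξ → ℝ≥0}

theorem thinnedRate_symm {G : Network Ξ} (h : ∀ d, ψ (G.emark (G.rev d)) = ψ (G.emark d)) (K : ℕ)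
    (x y : G.V) : thinnedRate ψ η K G x y = thinnedRate ψ η K G y x := by
  rw [thinnedRate, thinnedRate, weightRate_symm h x y]
  ring

theorem tsum_thinnedRate_le (ψ η : Ξ → ℝ≥0) (K : ℕ) (G : Network Ξ) (x : G.V) :
    ∑' y, thinnedRate ψ η K G x y ≤ ∑' y, G.weightRate ψ x y :=
  tsum_thinned_le (cutoff_le_one η K G) _ x

theorem tsum_walkKernel_le (hψ : ∀ m, ψ m ≤ η m) (K : ℕ) (G : Network Ξ) (x : G.V) :
    ∑' y, G.walkKernel ψ η K x y ≤ cutoffRate K :=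
  tsum_truncKernel_le (cutoff_le_one η K G) (fun _ => tsum_weightRate_le_cutoffRate hψ) x

/-- Where the cutoff is nonzero, the uniformization rate is at least twice the exit rate, so what
remains after one subtraction still dominates the row. Elsewhere the row is zero. -/
theorem tsum_thinnedRate_le_holdRate (hψ : ∀ m, ψ m ≤ η m) (K : ℕ) {G : Network Ξ}
    (hG : G.LocallyFinite) (x : G.V) :
    ∑' y, thinnedRate ψ η K G x y ≤ holdRate ψ K G x := by
  by_cases hx : G.cutoff η K x = 0
  · simp [thinnedRate, hx]
  · refine (tsum_thinnedRate_le ψ η K G x).trans ?_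
    rw [coe_holdRate ψ K hG]
    refine ENNReal.le_sub_of_add_le_left (tsum_weightRate_ne_top ψ hG x) ?_
    rw [← two_mul]
    exact two_mul_tsum_weightRate_le_of_cutoff_ne_zero hψ hx

theorem walkKernel_symm {G : Network Ξ} (h : ∀ d, ψ (G.emark (G.rev d)) = ψ (G.emark d)) (K : ℕ)
    (x y : G.V) : G.walkKernel ψ η K x y = G.walkKernel ψ η K y x := by
  simp only [walkKernel_eq, addDiag]
  rw [thinnedRate_symm h K x y]
  by_cases hxy : x = y
  · rw [hxy]
  · simp [kone, hxy, Ne.symm hxy]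

theorem posForm_walkKernel (hψ : ∀ m, ψ m ≤ η m) {G : Network Ξ} (hG : G.LocallyFinite)
    (h : ∀ d, ψ (G.emark (G.rev d)) = ψ (G.emark d)) (K : ℕ) : PosForm (G.walkKernel ψ η K) :=
  posForm_addDiag (thinnedRate_symm h K) (tsum_thinnedRate_le_holdRate hψ K hG)

/-- Increasing the weights by `δ` lowers the diagonal by at least the added thinned rates. -/
theorem tsum_thinnedRate_add_holdRate_le {ψ' δ : Ξ → ℝ≥0} (hψ' : ∀ m, ψ' m ≤ η m) (K : ℕ)
    {G : Network Ξ} (hG : G.LocallyFinite)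
    (h : ∀ d, ψ' (G.emark d) = ψ (G.emark d) + δ (G.emark d)) (x : G.V) :
    ∑' z, thinnedRate δ η K G x z + holdRate ψ' K G x ≤ holdRate ψ K G x := by
  have hsum : ∑' z, G.weightRate ψ' x z =
      ∑' z, G.weightRate ψ x z + ∑' z, G.weightRate δ x z := by
    rw [← ENNReal.tsum_add]
    exact tsum_congr fun z => weightRate_add G h x z
  rw [coe_holdRate ψ' K hG, coe_holdRate ψ K hG]
  by_cases hx : G.cutoff η K x = 0
  -- Here the hold rates may be truncated at `0`, but truncated subtraction is still antitone.
  · simp only [thinnedRate, hx, zero_mul, tsum_zero, zero_add]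
    exact tsub_le_tsub_left (hsum ▸ le_self_add) _
  · have h1 := tsum_weightRate_le_cutoffRate hψ' hx
    refine (add_le_add_left (tsum_thinnedRate_le δ η K G x) _).trans ?_
    refine ENNReal.le_sub_of_add_le_left (tsum_weightRate_ne_top ψ hG x) ?_
    rw [← add_assoc, ← hsum, add_tsub_cancel_of_le h1]

end Network

/-! ### The trace inequality for powers -/

section TraceInequality

open RootedNetwork Network

variable {Ξ : Type} [PseudoMetricSpace Ξ] {ν : Measure (NetworkSpace Ξ 1)}
  {ψ ψ' δ η : Ξ → ℝ≥0}

/-- Monotonicity of the trace against a symmetric positive kernel. -/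
theorem trace_kmul_walkKernel_mono (hν : IsUnimodular ν) (cψ : Continuous ψ)
    (cψ' : Continuous ψ') (cδ : Continuous δ) (cη : Continuous η) (hψ' : ∀ m, ψ' m ≤ η m) (K : ℕ)
    (hadd : ∀ᵐ p ∂ν, ∀ d : (Quotient.out p).net.D, ψ' ((Quotient.out p).net.emark d) =
      ψ ((Quotient.out p).net.emark d) + δ ((Quotient.out p).net.emark d))
    (hsymm : ∀ᵐ p ∂ν, ∀ d : (Quotient.out p).net.D,
      δ ((Quotient.out p).net.emark ((Quotient.out p).net.rev d)) =
        δ ((Quotient.out p).net.emark d))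
    {C : ∀ G : Network Ξ, G.V → G.V → ℝ≥0∞} (hC : IsLocalKernel C)
    (hpos : ∀ᵐ p ∂ν, ∀ x y, 2 * C (Quotient.out p).net x y ≤
      C (Quotient.out p).net x x + C (Quotient.out p).net y y) :
    trace ν (fun G => kmul (G.walkKernel ψ' η K) (C G)) ≤
      trace ν (fun G => kmul (G.walkKernel ψ η K) (C G)) := by
  -- `t` is common to both sides, `s` comes from the added jumps, and `r` from the diagonal mass
  -- given up for them. Only `∫ s ≤ ∫ r` needs unimodularity.
  set t : NetworkSpace Ξ 1 → ℝ≥0∞ := fun p =>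
    ∑' z, thinnedRate ψ η K (Quotient.out p).net (outRoot p) z *
      C (Quotient.out p).net z (outRoot p) +
    holdRate ψ' K (Quotient.out p).net (outRoot p) *
      C (Quotient.out p).net (outRoot p) (outRoot p) with ht
  set s : NetworkSpace Ξ 1 → ℝ≥0∞ := fun p =>
    ∑' z, thinnedRate δ η K (Quotient.out p).net (outRoot p) z *
      C (Quotient.out p).net z (outRoot p) with hs
  set r : NetworkSpace Ξ 1 → ℝ≥0∞ := fun p =>
    ∑' z, thinnedRate δ η K (Quotient.out p).net (outRoot p) z *
      C (Quotient.out p).net (outRoot p) (outRoot p) with hr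
  have mt : Measurable t :=
    ((localFn_tsum_thinnedRate_mul cψ cη K (0 : Fin 1) (hC.at (k := 2) 0 1)).add
      ((localFn_holdRate cψ' K (0 : Fin 1)).mul (hC.at 0 0))).measurable
  have mr : Measurable r :=
    (localFn_tsum_thinnedRate_mul cδ cη K (0 : Fin 1) (hC.at (k := 2) 1 1)).measurable
  have hsr : ∫⁻ p, s p ∂ν ≤ ∫⁻ p, r p ∂ν := by
    -- Transporting `thinnedRate δ (x,y) * C(x,x)` replaces `C(o,o)` by `C(z,z)`, so the pointwise
    -- bound on `2 C(z,o)` integrates to `2 ∫ r`.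
    have hswap : ∫⁻ p, r p ∂ν = ∫⁻ p, ∑' z, thinnedRate δ η K (Quotient.out p).net (outRoot p) z *
        C (Quotient.out p).net z z ∂ν := by
      rw [hr, lintegral_tsum_swap hν (X := fun G x y => thinnedRate δ η K G x y * C G x x)
        (((isLocalKernel_thinnedRate cδ cη K).at 0 1).mul (hC.at 0 0))]
      refine lintegral_congr_ae ?_
      filter_upwards [hsymm] with p hp
      exact tsum_congr fun z => by rw [thinnedRate_symm hp]
    have h2 : 2 * ∫⁻ p, s p ∂ν ≤ 2 * ∫⁻ p, r p ∂ν := by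
      rw [← lintegral_const_mul' _ _ ENNReal.ofNat_ne_top]
      calc ∫⁻ p, 2 * s p ∂ν ≤ ∫⁻ p, r p + ∑' z, thinnedRate δ η K (Quotient.out p).net
            (outRoot p) z * C (Quotient.out p).net z z ∂ν := by
            refine lintegral_mono_ae ?_
            filter_upwards [hpos] with p hp
            rw [hs, hr, ← ENNReal.tsum_add, ← ENNReal.tsum_mul_left]
            refine ENNReal.tsum_le_tsum fun z => ?_
            rw [← mul_add, mul_left_comm, add_comm]
            exact mul_le_mul_right (hp _ _) _
        _ = 2 * ∫⁻ p, r p ∂ν := by rw [lintegral_add_left mr, ← hswap, two_mul]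
    exact (ENNReal.mul_le_mul_iff_right two_ne_zero ENNReal.ofNat_ne_top).1 h2
  calc trace ν (fun G => kmul (G.walkKernel ψ' η K) (C G)) ≤ ∫⁻ p, t p + s p ∂ν := by
        refine lintegral_mono_ae ?_
        filter_upwards [hadd] with p hp
        simp only [walkKernel_eq, kmul_addDiag]
        rw [ht, hs, add_right_comm, ← ENNReal.tsum_add]
        refine add_le_add_left (ENNReal.tsum_le_tsum fun z => ?_) _
        rw [← add_mul, thinnedRate, thinnedRate, thinnedRate,
          weightRate_add _ hp, mul_add, add_mul]
    _ = ∫⁻ p, t p ∂ν + ∫⁻ p, s p ∂ν := lintegral_add_left mt _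
    _ ≤ ∫⁻ p, t p ∂ν + ∫⁻ p, r p ∂ν := add_le_add_right hsr _
    _ = ∫⁻ p, t p + r p ∂ν := (lintegral_add_left mt _).symm
    _ ≤ trace ν (fun G => kmul (G.walkKernel ψ η K) (C G)) := by
        refine lintegral_mono_ae ?_
        filter_upwards [hadd] with p hp
        simp only [walkKernel_eq, kmul_addDiag]
        simp only [ht, hr]
        rw [ENNReal.tsum_mul_right, add_assoc, ← add_mul, add_comm (holdRate ψ' K _ _ : ℝ≥0∞)]
        refine add_le_add_right (mul_le_mul_left ?_ _) _
        exact tsum_thinnedRate_add_holdRate_le hψ' K (Quotient.out p).locallyFinite hp _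

/-- A convex sequence with nonnegative first increment is nondecreasing; finiteness permits the
cancellations. -/
theorem le_of_two_mul_le {c : ℕ → ℝ≥0∞} {m : ℕ} (hfin : ∀ i, c i ≠ ∞)
    (h1 : 0 < m → c 0 ≤ c 1) (h : ∀ i, i + 2 ≤ m → 2 * c (i + 1) ≤ c i + c (i + 2)) :
    c 0 ≤ c m := by
  have hstep : ∀ i, i < m → c i ≤ c (i + 1) := by
    intro i
    induction i with
    | zero => exact h1
    | succ i ih =>
      intro hi
      have h2 := h i hi
      have h3 := ih (by omega)
      rw [two_mul] at h2
      have h4 : c i + c (i + 1) ≤ c i + c (i + 2) := (add_le_add_left h3 _).trans h2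
      exact (ENNReal.add_le_add_iff_left (hfin i)).1 h4
  have : ∀ i, i ≤ m → c 0 ≤ c i := by
    intro i
    induction i with
    | zero => exact fun _ => le_rfl
    | succ i ih => exact fun hi => (ih (by omega)).trans (hstep i hi)
  exact this m le_rfl

/-- Larger weights have a smaller expected diagonal entry of each power of the walk kernel. -/
theorem trace_kpow_walkKernel_le (hν : IsUnimodular ν) (cψ : Continuous ψ)
    (cψ' : Continuous ψ') (cδ : Continuous δ) (cη : Continuous η) (hψ : ∀ m, ψ m ≤ η m)
    (hψ' : ∀ m, ψ' m ≤ η m) (K : ℕ)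
    (hadd : ∀ᵐ p ∂ν, ∀ d : (Quotient.out p).net.D, ψ' ((Quotient.out p).net.emark d) =
      ψ ((Quotient.out p).net.emark d) + δ ((Quotient.out p).net.emark d))
    (hsymm : ∀ᵐ p ∂ν, (Quotient.out p).net.SymmetricEdgeMarks) (n : ℕ) :
    trace ν (fun G => kpow (G.walkKernel ψ' η K) n) ≤
      trace ν (fun G => kpow (G.walkKernel ψ η K) n) := by
  have hlocal : ∀ i j, IsLocalKernel fun G : Network Ξ =>
      kmul (kpow (G.walkKernel ψ' η K) i) (kpow (G.walkKernel ψ η K) j) := fun i j =>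
    (isLocalKernel_kpow_walkKernel cψ cη K j).kpow_walkKernel_kmul cψ' cη K i
  have hsymmψ : ∀ {φ : Ξ → ℝ≥0}, ∀ᵐ p ∂ν, ∀ d : (Quotient.out p).net.D,
      φ ((Quotient.out p).net.emark ((Quotient.out p).net.rev d)) =
        φ ((Quotient.out p).net.emark d) := by
    intro φ
    filter_upwards [hsymm] with p hp d
    rw [hp d]
  have hmono : ∀ {C : ∀ G : Network Ξ, G.V → G.V → ℝ≥0∞}, IsLocalKernel C →
      (∀ᵐ p ∂ν, ∀ x y, 2 * C (Quotient.out p).net x y ≤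
        C (Quotient.out p).net x x + C (Quotient.out p).net y y) →
      trace ν (fun G => kmul (G.walkKernel ψ' η K) (C G)) ≤
        trace ν (fun G => kmul (G.walkKernel ψ η K) (C G)) :=
    trace_kmul_walkKernel_mono hν cψ cψ' cδ cη hψ' K hadd hsymmψ
  have hpow : ∀ {φ : Ξ → ℝ≥0}, (∀ m, φ m ≤ η m) → ∀ k, ∀ᵐ p ∂ν, ∀ x y,
      2 * kpow ((Quotient.out p).net.walkKernel φ η K) k x y ≤
        kpow ((Quotient.out p).net.walkKernel φ η K) k x x +
          kpow ((Quotient.out p).net.walkKernel φ η K) k y y := by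
    intro φ hφ k
    filter_upwards [hsymmψ (φ := φ)] with p hp
    exact (posForm_walkKernel hφ (Quotient.out p).locallyFinite hp K).two_mul_kpow_le
      (walkKernel_symm hp K) k
  set b : ℕ → ℕ → ℝ≥0∞ := fun i j => trace ν fun G =>
    kmul (kpow (G.walkKernel ψ' η K) i) (kpow (G.walkKernel ψ η K) j) with hb
  have hfin : ∀ i j, b i j ≠ ∞ := fun i j => by
    refine ne_top_of_le_ne_top ?_ (trace_le hν.1 fun G x => tsum_kmul_le
      (tsum_kpow_le (tsum_walkKernel_le hψ' K G) i) (tsum_kpow_le (tsum_walkKernel_le hψ K G) j) x)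
    exact ENNReal.mul_ne_top (ENNReal.pow_ne_top ENNReal.coe_ne_top)
      (ENNReal.pow_ne_top ENNReal.coe_ne_top)
  -- Cyclicity of the trace puts powers of the smaller-weight kernel on both sides.
  have hsandwich : ∀ i j k, trace ν (fun G => kmul (kpow (G.walkKernel ψ η K) j)
      (kmul (kpow (G.walkKernel ψ' η K) i) (kpow (G.walkKernel ψ η K) k))) = b i (k + j) := by
    intro i j k
    rw [trace_kmul_comm hν (isLocalKernel_kpow_walkKernel cψ cη K j) (hlocal i k)]
    simp only [hb, kmul_assoc, kpow_add]
  -- Monotonicity against `C = X'^i`, which is a power of a single kernel and so satisfies the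
  -- required inequality.
  have hfirst : ∀ i, b (i + 1) 0 ≤ b i 1 := by
    intro i
    have h := hmono (isLocalKernel_kpow_walkKernel cψ' cη K i) (hpow hψ' i)
    have h2 := hsandwich i 1 0
    simp only [kpow, kmul_kone, zero_add] at h2
    rw [← h2]
    simpa only [hb, kpow, kmul_kone] using h
  -- Cauchy–Schwarz for the form of `X'^e`, applied to the root rows of `X^i X'^(m-i)` and `X^j
  -- X'^(m-j)`.
  have hcs : ∀ (e m i j : ℕ), e < 2 → i ≤ m → j ≤ m → 2 * b (m - i + (m - j) + e) (i + j) ≤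
      b (2 * (m - i) + e) (2 * i) + b (2 * (m - j) + e) (2 * j) := by
    intro e m i j he hi hj
    have hform : ∀ i j, b (m - i + (m - j) + e) (i + j) = ∫⁻ p, kform
        (kpow ((Quotient.out p).net.walkKernel ψ' η K) e)
        (kmul (kpow ((Quotient.out p).net.walkKernel ψ η K) i)
          (kpow ((Quotient.out p).net.walkKernel ψ' η K) (m - i)) (outRoot p))
        (kmul (kpow ((Quotient.out p).net.walkKernel ψ η K) j)
          (kpow ((Quotient.out p).net.walkKernel ψ' η K) (m - j)) (outRoot p)) ∂ν := by
      intro i j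
      rw [add_comm i j, ← hsandwich, trace]
      refine lintegral_congr_ae ?_
      filter_upwards [hsymmψ (φ := ψ), hsymmψ (φ := ψ')] with p hp hp'
      rw [add_right_comm, kpow_add, kpow_add, ← kmul_assoc, ← kmul_assoc, ← kmul_assoc,
        kmul_assoc, kmul_kmul_apply]
      congr 1
      funext z
      exact kmul_swap (kpow_symm (walkKernel_symm hp' K) _) (kpow_symm (walkKernel_symm hp K) _) z _
    have hform' : ∀ i, b (2 * (m - i) + e) (2 * i) = b (m - i + (m - i) + e) (i + i) := fun i => by
      rw [two_mul, two_mul]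
    rw [hform' i, hform' j, hform i j, ← lintegral_const_mul' _ _ ENNReal.ofNat_ne_top]
    -- The first summand is rewritten as a kernel product, known to be measurable, so that the
    -- integral of the sum splits.
    have hle : ∫⁻ p, 2 * kform
        (kpow ((Quotient.out p).net.walkKernel ψ' η K) e)
        (kmul (kpow ((Quotient.out p).net.walkKernel ψ η K) i)
          (kpow ((Quotient.out p).net.walkKernel ψ' η K) (m - i)) (outRoot p))
        (kmul (kpow ((Quotient.out p).net.walkKernel ψ η K) j)
          (kpow ((Quotient.out p).net.walkKernel ψ' η K) (m - j)) (outRoot p)) ∂ν ≤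
        ∫⁻ p, kmul (kmul (kpow ((Quotient.out p).net.walkKernel ψ η K) i)
            (kpow ((Quotient.out p).net.walkKernel ψ' η K) (m - i + (m - i) + e)))
            (kpow ((Quotient.out p).net.walkKernel ψ η K) i) (outRoot p) (outRoot p) +
          kform (kpow ((Quotient.out p).net.walkKernel ψ' η K) e)
            (kmul (kpow ((Quotient.out p).net.walkKernel ψ η K) j)
              (kpow ((Quotient.out p).net.walkKernel ψ' η K) (m - j)) (outRoot p))
            (kmul (kpow ((Quotient.out p).net.walkKernel ψ η K) j)
              (kpow ((Quotient.out p).net.walkKernel ψ' η K) (m - j)) (outRoot p)) ∂ν := by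
      refine lintegral_mono_ae ?_
      filter_upwards [hsymmψ (φ := ψ), hsymmψ (φ := ψ')] with p hp hp'
      refine (((posForm_walkKernel hψ' (Quotient.out p).locallyFinite hp' K).kpow_zero_or_one he)
        _ _).trans_eq ?_
      congr 1
      rw [add_right_comm, kpow_add, kpow_add, ← kmul_assoc, ← kmul_assoc,
        kmul_assoc, kmul_kmul_apply]
      congr 1
      funext z
      exact kmul_swap (kpow_symm (walkKernel_symm hp K) _) (kpow_symm (walkKernel_symm hp' K) _) _ z
    refine hle.trans_eq ?_
    rw [lintegral_add_left, ← hform j j, ← hsandwich (m - i + (m - i) + e) i i]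
    · congr 1
      exact lintegral_congr fun p => by rw [kmul_assoc]
    · simp only [kmul_assoc]
      exact (((hlocal _ i).kpow_walkKernel_kmul cψ cη K i).at (k := 1) 0 0).measurable
  obtain ⟨m, e, he, rfl⟩ : ∃ m e, e < 2 ∧ n = 2 * m + e := ⟨n / 2, n % 2, by omega, by omega⟩
  have hchain : b (2 * m + e) 0 ≤ b e (2 * m) := by
    have h := le_of_two_mul_le (c := fun i => b (2 * (m - i) + e) (2 * i)) (m := m)
      (fun i => hfin _ _) (fun hm => ?_) (fun i hi => ?_)
    · simpa using h
    -- The mixed term here is `b (2m - 1 + e) 1`, which `hfirst` bounds below by `c 0`; cancelling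
    -- one finite copy of `c 0` gives `c 0 ≤ c 1`.
    · have h1 := hcs e m 0 1 he m.zero_le hm
      have h2 := hfirst (m - 0 + (m - 1) + e)
      rw [show m - 0 + (m - 1) + e + 1 = 2 * (m - 0) + e by omega] at h2
      have h3 : b (2 * (m - 0) + e) (2 * 0) + b (2 * (m - 0) + e) (2 * 0) ≤
          b (2 * (m - 0) + e) (2 * 0) + b (2 * (m - 1) + e) (2 * 1) := by
        refine le_trans ?_ h1
        rw [← two_mul]
        exact mul_le_mul_right h2 _
      exact (ENNReal.add_le_add_iff_left (hfin _ _)).1 h3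
    · have h1 := hcs e m i (i + 2) he (by omega) hi
      rw [show m - i + (m - (i + 2)) + e = 2 * (m - (i + 1)) + e by omega,
        show i + (i + 2) = 2 * (i + 1) by omega] at h1
      exact h1
  -- For odd `n` one factor `X'` is left; it is replaced by monotonicity against `C = X^(2m)`.
  have hlast : b e (2 * m) ≤ b 0 (2 * m + e) := by
    interval_cases e
    · exact le_rfl
    · have h := hmono (isLocalKernel_kpow_walkKernel cψ cη K (2 * m)) (hpow hψ (2 * m))
      simp only [hb, kpow_one]
      simpa only [kpow, kone_kmul] using h
  simpa only [hb, kpow, kone_kmul, kmul_kone] using hchain.trans hlast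

end TraceInequality

/-! ### Removing the truncation -/

section Limit

open RootedNetwork Network

variable {Ξ : Type} {ψ η : Ξ → ℝ≥0}

/-- The truncated return probability at the root. -/
def truncReturn (ψ η : Ξ → ℝ≥0) (K : ℕ) (t : ℝ) (p : NetworkSpace Ξ 1) : ℝ≥0∞ :=
  truncTransition ((Quotient.out p).net.cutoff η K) (cutoffRate K)
    ((Quotient.out p).net.weightRate ψ) t (outRoot p) (outRoot p)

/-- The return probability at the root of the walk with edge weights `ψ`. -/
def weightReturn (ψ : Ξ → ℝ≥0) (t : ℝ) (p : NetworkSpace Ξ 1) : ℝ≥0∞ :=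
  minimalTransition ((Quotient.out p).net.mapMarks ψ).rate t (outRoot p) (outRoot p)

theorem tendsto_truncReturn (hψ : ∀ m, ψ m ≤ η m) {t : ℝ} (ht : 0 ≤ t) (p : NetworkSpace Ξ 1) :
    Tendsto (fun K => truncReturn ψ η K t p) atTop (𝓝 (weightReturn ψ t p)) :=
  Network.tendsto_truncTransition hψ (Quotient.out p).locallyFinite ht _ _

theorem truncReturn_le_one (hψ : ∀ m, ψ m ≤ η m) (K : ℕ) {t : ℝ} (ht : 0 ≤ t)
    (p : NetworkSpace Ξ 1) : truncReturn ψ η K t p ≤ 1 :=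
  poisson_mixture_le_one (tsum_walkKernel_le hψ K _) ht _ _

variable [PseudoMetricSpace Ξ]

theorem measurable_kpow_walkKernel (cψ : Continuous ψ) (cη : Continuous η) (K n : ℕ) :
    Measurable fun p : NetworkSpace Ξ 1 =>
      kpow ((Quotient.out p).net.walkKernel ψ η K) n (outRoot p) (outRoot p) :=
  ((isLocalKernel_kpow_walkKernel cψ cη K n).at (k := 1) 0 0).measurable

theorem measurable_truncReturn (cψ : Continuous ψ) (cη : Continuous η) (K : ℕ) (t : ℝ) :
    Measurable (truncReturn ψ η K t) :=
  (Measurable.tsum fun n =>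
    (measurable_kpow_walkKernel cψ cη K n).const_mul _).const_mul _

theorem measurable_weightReturn (cψ : Continuous ψ) {t : ℝ} (ht : 0 ≤ t) :
    Measurable (weightReturn ψ t) :=
  measurable_of_tendsto_metrizable (fun K => measurable_truncReturn cψ cψ K t)
    (tendsto_pi_nhds.2 fun p => tendsto_truncReturn (fun _ => le_rfl) ht p)

theorem tendsto_lintegral_truncReturn {ν : Measure (NetworkSpace Ξ 1)} [IsProbabilityMeasure ν]
    (cψ : Continuous ψ) (cη : Continuous η) (hψ : ∀ m, ψ m ≤ η m) {t : ℝ} (ht : 0 ≤ t) :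
    Tendsto (fun K => ∫⁻ p, truncReturn ψ η K t p ∂ν) atTop (𝓝 (∫⁻ p, weightReturn ψ t p ∂ν)) :=
  tendsto_lintegral_of_dominated_convergence (fun _ => 1)
    (fun K => measurable_truncReturn cψ cη K t)
    (fun K => .of_forall fun p => truncReturn_le_one hψ K ht p) (by simp)
    (.of_forall fun p => tendsto_truncReturn hψ ht p)

theorem lintegral_truncReturn {ν : Measure (NetworkSpace Ξ 1)} (cψ : Continuous ψ)
    (cη : Continuous η) (K : ℕ) (t : ℝ) :
    ∫⁻ p, truncReturn ψ η K t p ∂ν = ENNReal.ofReal (Real.exp (-(cutoffRate K * t))) *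
      ∑' n : ℕ, ENNReal.ofReal (t ^ n / (n.factorial : ℝ)) *
        trace ν fun G => kpow (G.walkKernel ψ η K) n := by
  refine (lintegral_const_mul' _ _ ENNReal.ofReal_ne_top).trans (congrArg _ ?_)
  refine (lintegral_tsum fun n =>
    ((measurable_kpow_walkKernel cψ cη K n).const_mul _).aemeasurable).trans ?_
  exact tsum_congr fun n => lintegral_const_mul' _ _ ENNReal.ofReal_ne_top

/-- Larger weights have a smaller expected return probability. -/
theorem lintegral_weightReturn_le {ν : Measure (NetworkSpace Ξ 1)} (hν : IsUnimodular ν)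
    {ψ' δ : Ξ → ℝ≥0} (cψ : Continuous ψ) (cψ' : Continuous ψ') (cδ : Continuous δ)
    (hadd : ∀ᵐ p ∂ν, ∀ d : (Quotient.out p).net.D, ψ' ((Quotient.out p).net.emark d) =
      ψ ((Quotient.out p).net.emark d) + δ ((Quotient.out p).net.emark d))
    (hsymm : ∀ᵐ p ∂ν, (Quotient.out p).net.SymmetricEdgeMarks) {t : ℝ} (ht : 0 ≤ t) :
    ∫⁻ p, weightReturn ψ' t p ∂ν ≤ ∫⁻ p, weightReturn ψ t p ∂ν := by
  have := hν.1
  -- The sum of the weights dominates both, so the two walks share one cutoff and one uniformization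
  -- rate.
  have cη : Continuous fun m => ψ m + ψ' m := cψ.add cψ'
  have hψ : ∀ m, ψ m ≤ ψ m + ψ' m := fun m => le_self_add
  have hψ' : ∀ m, ψ' m ≤ ψ m + ψ' m := fun m => le_add_self
  refine le_of_tendsto_of_tendsto' (tendsto_lintegral_truncReturn cψ' cη hψ' ht)
    (tendsto_lintegral_truncReturn cψ cη hψ ht) fun K => ?_
  rw [lintegral_truncReturn cψ' cη, lintegral_truncReturn cψ cη]
  refine mul_le_mul_right (ENNReal.tsum_le_tsum fun n => mul_le_mul_right ?_ _) _
  exact trace_kpow_walkKernel_le hν cψ cψ' cδ cη hψ hψ' K hadd hsymm n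

end Limit

/-! ### From the coupling to its marginals -/

theorem mapMarks_eq_mk_out {Ξ Ξ' : Type} {k : ℕ} (f : Ξ → Ξ') (p : NetworkSpace Ξ k) :
    NetworkSpace.mapMarks f p = NetworkSpace.mk ((Quotient.out p).mapMarks f) := by
  conv_lhs => rw [← Quotient.out_eq p]
  rfl

theorem returnProb_eq_weightReturn (t : ℝ) : returnProb t = weightReturn (fun m => m) t := by
  funext p
  conv_lhs => rw [← Quotient.out_eq p]
  rfl

theorem lintegral_returnProb_map {Ξ : Type} [PseudoMetricSpace Ξ] {ν : Measure (NetworkSpace Ξ 1)}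
    {ψ : Ξ → ℝ≥0} (hψ : AEMeasurable (NetworkSpace.mapMarks (k := 1) ψ) ν) {t : ℝ} (ht : 0 ≤ t) :
    ∫⁻ p, returnProb t p ∂(ν.map (NetworkSpace.mapMarks ψ)) = ∫⁻ p, weightReturn ψ t p ∂ν := by
  have hm : Measurable (returnProb t) := by
    rw [returnProb_eq_weightReturn]
    exact measurable_weightReturn continuous_id ht
  rw [lintegral_map' hm.aemeasurable hψ]
  refine lintegral_congr fun p => ?_
  rw [mapMarks_eq_mk_out]
  rfl

end UnimodularNetwork

end

theorem theoremt
    (μ₁ μ₂ : Measure (NetworkSpace ℝ≥0 1))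
    (hμ₁ : IsUnimodular μ₁) (hμ₂ : IsUnimodular μ₂)
    (hsymm₁ : ∀ᵐ p ∂μ₁, NetworkSpace.SymmetricEdgeMarks p)
    (hsymm₂ : ∀ᵐ p ∂μ₂, NetworkSpace.SymmetricEdgeMarks p)
    (ν : Measure (NetworkSpace (ℝ≥0 × ℝ≥0) 1))
    (hν : IsUnimodular ν)
    (hcoupling : IsCoupling {m : ℝ≥0 × ℝ≥0 | m.1 ≤ m.2} ν μ₁ μ₂)
    (t : ℝ) (ht : 0 < t) :
    ∫⁻ p, returnProb t p ∂μ₂ ≤ ∫⁻ p, returnProb t p ∂μ₁ := by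
  -- `Measure.map` is zero for maps that are not a.e. measurable; the marginals are probability
  -- measures, so measurability of the projections is automatic.
  have hfst : AEMeasurable (NetworkSpace.mapMarks (k := 1) (Prod.fst : ℝ≥0 × ℝ≥0 → ℝ≥0)) ν :=
    AEMeasurable.of_map_ne_zero (by rw [hcoupling.fst]; exact hμ₁.1.ne_zero)
  have hsnd : AEMeasurable (NetworkSpace.mapMarks (k := 1) (Prod.snd : ℝ≥0 × ℝ≥0 → ℝ≥0)) ν :=
    AEMeasurable.of_map_ne_zero (by rw [hcoupling.snd]; exact hμ₂.1.ne_zero)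
  rw [← hcoupling.fst] at hsymm₁ ⊢
  rw [← hcoupling.snd] at hsymm₂ ⊢
  rw [lintegral_returnProb_map hfst ht.le, lintegral_returnProb_map hsnd ht.le]
  -- Truncated subtraction keeps `δ` continuous on all marks; it is the true difference almost
  -- surely, by the coupling.
  refine lintegral_weightReturn_le hν (δ := fun m => m.2 - m.1) continuous_fst continuous_snd
    (continuous_snd.sub continuous_fst) ?_ ?_ ht.le
  · filter_upwards [hcoupling.marksIn] with p hp d
    exact (add_tsub_cancel_of_le ((hp (Quotient.out p) (Quotient.out_eq p)).2 d)).symm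
  · filter_upwards [ae_of_ae_map hfst hsymm₁, ae_of_ae_map hsnd hsymm₂] with p hp₁ hp₂ d
    rw [mapMarks_eq_mk_out] at hp₁ hp₂
    exact Prod.ext (hp₁ _ rfl d) (hp₂ _ rfl d)
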